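/- Let $\{r_1,\dots,r_n\}$ be a $C^2$ frame on an open set $\Omega\subset\mathbb R^n$ with coordinates $u$: $r_i$ is given by a $C^2$ column-vector field $R_i(u)$, and $R_1(u),\dots,R_n(u)$ are linearly independent at every $u\in\Omega$. Let $L=[R_1|\cdots|R_n]^{-1}$ with rows $L^k$, and put $$\Gamma_{ij}^k=L^k\,(DR_j)\,R_i,\qquad c_{ij}^k=\Gamma_{ij}^k-\Gamma_{ji}^k .$$ Suppose the frame is rich ($c_{ij}^k=0$ whenever $i,j,k$ are distinct) and that $\rho=(w^1,\dots,w^n)$ is a differentiable homeomorphism of $\Omega$ onto an open set $W\subset\mathbb R^n$ (Riemann coordinates) normalized so that $r_j(w^i)=\delta^i_j$, i.e. $r_i=\partial/\partial w^i=:\partial_i$. Put $Z_{ij}^k=\Gamma_{ij}^k\circ\rho^{-1}$ and assume that $Z_{ij}^k=0$ on $W$ whenever $i,j,k$ are distinct. Let $\bar w\in W$ and $\bar u=\rho^{-1}(\bar w)$. Then the algebraic part $Z_{ik}^j\gamma^j=Z_{jk}^i\gamma^i$ ($i<j$, $k\ne i,j$) of the $\beta$-system holds on $W$ for every $\gamma$.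 Moreover, for any functions $\varphi_1,\dots,\varphi_n$ of one variable, with $\varphi_i$ of class $C^1$ near $\bar w^i$, the following hold. 1. The $\beta$-system $$\partial_i\gamma^j=Z_{ji}^j\gamma^j-Z_{jj}^i\gamma^i\qquad(1\le i\ne j\le n)$$ has a unique local $C^1$ solution $\gamma=(\gamma^1,\dots,\gamma^n)$ near $\bar w$ with $$\gamma^i(\bar w^1,\dots,\bar w^{i-1},w^i,\bar w^{i+1},\dots,\bar w^n)=\varphi_i(w^i),\qquad i=1,\dots,n.$$ That is, there are an open neighbourhood $U\subset W$ of $\bar w$ and a $C^1$ solution $\gamma$ on $U$ with these data, every $C^1$ solution on $U$ with these data equals $\gamma$ on $U$, and every $C^1$ solution with these data on any open neighbourhood of $\bar w$ in $W$ agrees with $\gamma$ near $\bar w$. 2. Consequently the extensions, i.e. the $C^3$ functions $\eta$ near $\bar u$ with $R_i^T(D^2_u\eta)R_j=0$ for all $i\ne j$, depend on $n$ arbitrary functions of one variable: there is an extension $\eta$ on a neighbourhood of $\bar u$ such that the functions $\gamma^i=\big(R_i^T(D_u^2\eta)R_i\big)\circ\rho^{-1}$ satisfy the data condition in 1, and any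 extension on a neighbourhood of $\bar u$ with the same data differs from $\eta$ near $\bar u$ by an affine function $a\cdot u+b$. -/

import Mathlib

open Set Filter Topology

namespace BetaSystem

noncomputable section

/-- The matrix `R(u) = [R_1(u) | ⋯ | R_n(u)]` whose columns are the coordinate vectors at `u` of
the vector fields `r_1, …, r_n` (`R i` is the column vector field `R_i`). -/
def frameMatrix {n : ℕ} (R : Fin n → (Fin n → ℝ) → (Fin n → ℝ)) (u : Fin n → ℝ) :
    Matrix (Fin n) (Fin n) ℝ :=
  Matrix.of fun k i => R i u k

/-- The matrix `L(u) = R(u)⁻¹`; its rows `L^k(u)` represent the dual coframe. -/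
def coframeMatrix {n : ℕ} (R : Fin n → (Fin n → ℝ) → (Fin n → ℝ)) (u : Fin n → ℝ) :
    Matrix (Fin n) (Fin n) ℝ :=
  (frameMatrix R u)⁻¹

/-- A `C²` frame on `Ω`: `n` vector fields of class `C²`, linearly independent at each point. -/
def IsFrameOn {n : ℕ} (R : Fin n → (Fin n → ℝ) → (Fin n → ℝ)) (Ω : Set (Fin n → ℝ)) : Prop :=
  (∀ i, ContDiffOn ℝ 2 (R i) Ω) ∧ ∀ u ∈ Ω, LinearIndependent ℝ (fun i => R i u)

/-- The connection coefficients `Γ_{ij}^k = L^k (D R_j) R_i`. -/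
def christoffel {n : ℕ} (R : Fin n → (Fin n → ℝ) → (Fin n → ℝ)) (i j k : Fin n)
    (u : Fin n → ℝ) : ℝ :=
  ∑ m, coframeMatrix R u k m * fderiv ℝ (R j) u (R i u) m

/-- The structure coefficients `c_{ij}^k = Γ_{ij}^k - Γ_{ji}^k`. -/
def structureCoeff {n : ℕ} (R : Fin n → (Fin n → ℝ) → (Fin n → ℝ)) (i j k : Fin n)
    (u : Fin n → ℝ) : ℝ :=
  christoffel R i j k u - christoffel R j i k u

/-- The frame is rich on `Ω`: `c_{ij}^k = 0` whenever `i, j, k` are distinct. -/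
def IsRichOn {n : ℕ} (R : Fin n → (Fin n → ℝ) → (Fin n → ℝ)) (Ω : Set (Fin n → ℝ)) : Prop :=
  ∀ i j k : Fin n, i ≠ j → j ≠ k → i ≠ k → ∀ u ∈ Ω, structureCoeff R i j k u = 0

/-- `ρ = (w^1, …, w^n)` is a system of Riemann coordinates on the open set `ρ.source`, normalized
by `r_j(w^i) = δ^i_j`, that is, `r_i = ∂/∂w^i`. -/
def IsRiemannCoordinates {n : ℕ} (R : Fin n → (Fin n → ℝ) → (Fin n → ℝ))
    (ρ : OpenPartialHomeomorph (Fin n → ℝ) (Fin n → ℝ)) : Prop :=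
  ∀ u ∈ ρ.source, DifferentiableAt ℝ ρ u ∧
    ∀ i j : Fin n, fderiv ℝ ρ u (R j u) i = if i = j then 1 else 0

/-- The connection coefficients in Riemann coordinates, `Z_{ij}^k = Γ_{ij}^k ∘ ρ⁻¹`. -/
def riemannChristoffel {n : ℕ} (R : Fin n → (Fin n → ℝ) → (Fin n → ℝ))
    (ρ : OpenPartialHomeomorph (Fin n → ℝ) (Fin n → ℝ)) (i j k : Fin n) (w : Fin n → ℝ) : ℝ :=
  christoffel R i j k (ρ.symm w)

/-- The algebraic part of the `β`-system in Riemann coordinates, as a condition on the values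
`g = (γ^1(w), …, γ^n(w))` at the point `w`: `Z_{ik}^j γ^j = Z_{jk}^i γ^i` for `i < j`,
`k ≠ i, j`. -/
def BetaAlgebraicAt {n : ℕ} (R : Fin n → (Fin n → ℝ) → (Fin n → ℝ))
    (ρ : OpenPartialHomeomorph (Fin n → ℝ) (Fin n → ℝ)) (w g : Fin n → ℝ) : Prop :=
  ∀ i j k : Fin n, i < j → k ≠ i → k ≠ j →
    riemannChristoffel R ρ i k j w * g j = riemannChristoffel R ρ j k i w * g i

/-- `γ = (γ^1, …, γ^n)` is a `C¹` solution on the open set `U` of the differential part of the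
`β`-system in Riemann coordinates: `∂_i γ^j = Z_{ji}^j γ^j - Z_{jj}^i γ^i` for `i ≠ j`. -/
def IsBetaSolutionOn {n : ℕ} (R : Fin n → (Fin n → ℝ) → (Fin n → ℝ))
    (ρ : OpenPartialHomeomorph (Fin n → ℝ) (Fin n → ℝ))
    (U : Set (Fin n → ℝ)) (γ : (Fin n → ℝ) → (Fin n → ℝ)) : Prop :=
  ContDiffOn ℝ 1 γ U ∧ ∀ w ∈ U, ∀ i j : Fin n, i ≠ j →
    fderiv ℝ γ w (Pi.single i 1) j =
      riemannChristoffel R ρ j i j w * γ w j - riemannChristoffel R ρ j j i w * γ w i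

/-- `γ^i(w̄^1, …, w^i, …, w̄^n) = φ_i(w^i)` at the points of `U` on the `i`-th coordinate line
through `w̄`, for each `i`. -/
def HasDataOn {n : ℕ} (wbar : Fin n → ℝ) (φ : Fin n → ℝ → ℝ)
    (U : Set (Fin n → ℝ)) (γ : (Fin n → ℝ) → (Fin n → ℝ)) : Prop :=
  ∀ (i : Fin n) (t : ℝ), Function.update wbar i t ∈ U → γ (Function.update wbar i t) i = φ i t

/-- The Hessian form `X^T (D²η(u)) Y`. -/
def hessian {n : ℕ} (η : (Fin n → ℝ) → ℝ) (u X Y : Fin n → ℝ) : ℝ :=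
  fderiv ℝ (fderiv ℝ η) u X Y

/-- `η` is an extension on the open set `V` for the frame `R`: a `C³` function with
`R_i^T (D²η) R_j = 0` for `i ≠ j`. -/
def IsExtensionOn {n : ℕ} (R : Fin n → (Fin n → ℝ) → (Fin n → ℝ)) (V : Set (Fin n → ℝ))
    (η : (Fin n → ℝ) → ℝ) : Prop :=
  ContDiffOn ℝ 3 η V ∧ ∀ u ∈ V, ∀ i j : Fin n, i ≠ j → hessian η u (R i u) (R j u) = 0

/-- The functions `β^i = R_i^T (D²η) R_i` of `η`, in Riemann coordinates: `γ^i = β^i ∘ ρ⁻¹`. -/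
def lengths {n : ℕ} (R : Fin n → (Fin n → ℝ) → (Fin n → ℝ))
    (ρ : OpenPartialHomeomorph (Fin n → ℝ) (Fin n → ℝ)) (η : (Fin n → ℝ) → ℝ)
    (w : Fin n → ℝ) : Fin n → ℝ :=
  fun i => hessian η (ρ.symm w) (R i (ρ.symm w)) (R i (ρ.symm w))

end

end BetaSystem

/-!
In Riemann coordinates the frame fields are the partial derivatives of `ρ⁻¹`, which is of class
`C³` since its differential is the `C²` frame. So `∂_i R_j = Σ_k Z_{ij}^k R_k` with `C¹`
coefficients, and the equality of mixed partial derivatives says that the connection `Z` has no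
torsion (`BetaSystem.riemannChristoffel_symm`) and is flat (`BetaSystem.riemannChristoffel_flat`).

The differential part of the `β`-system is a linear Darboux system
`∂_i γ^j = a_{ij} γ^j + b_{ij} γ^i`, `i ≠ j`: each unknown has all its derivatives prescribed but
the one in its own direction, and is given on the axis of that direction. If `Z_{ij}^k = 0` for
distinct `i, j, k`, then flatness is exactly the equality of the mixed derivatives of the prescribed
right-hand sides, modulo the system (`BetaSystem.compatibleAt_beta`).

A compatible linear Darboux system is solved near a point by Picard iteration
(`DarbouxSystem.eventually_exists_unique_solution`). Integrating the prescribed derivatives of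
`γ^j` along the segment from the `j`-th axis to `w` on which the `j`-th coordinate is constant gives
an integral equation whose operator gains a factor of the radius of the ball. On small balls its
Picard series converges in `C¹` (`DarbouxSystem.SmallCoeffs.exists_eq_add_picard`). By the
compatibility conditions, the failure of the limit to solve the system satisfies a homogeneous
linear integral equation of the same kind, so it vanishes
(`DarbouxSystem.SmallCoeffs.defect_eq_zero`). Uniqueness is the same contraction argument.

For the extensions, consider a `C¹` field `H` of bilinear forms with `H(R_j, R_k) = δ_{jk} γ^j`.
Differentiating this identity shows that `DH` is symmetric in its first two arguments if and only if
`γ` solves the `β`-system (`BetaSystem.fderiv_diagonal_symm_iff`). Hence the lengths of an extension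
solve the `β`-system, and conversely, for a solution `γ`, the form `Σ_i γ^i dw^i ⊗ dw^i` is a
Hessian by the Poincaré lemma, applied twice on a ball. Extensions with the same data have the same
Hessian near the base point and so differ by an affine function.
-/

namespace DarbouxSystem

open Metric MeasureTheory

noncomputable section

variable {n : ℕ} {c : Fin n → ℝ} {r : ℝ}

/-! ### Averages over segments that fix one coordinate -/

/-- The linear map of `ℝⁿ` that keeps the `j`-th coordinate and multiplies the others by `t`. -/
def scaleOff (j : Fin n) (t : ℝ) : (Fin n → ℝ) →L[ℝ] (Fin n → ℝ) :=
  t • ContinuousLinearMap.id ℝ (Fin n → ℝ) +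
    (1 - t) • (ContinuousLinearMap.single ℝ (fun _ : Fin n => ℝ) j).comp
      (ContinuousLinearMap.proj j)

lemma scaleOff_apply (j : Fin n) (t : ℝ) (v : Fin n → ℝ) (i : Fin n) :
    scaleOff j t v i = if i = j then v i else t * v i := by
  by_cases h : i = j
  · subst h; simp [scaleOff]; ring
  · simp [scaleOff, h]

lemma continuous_scaleOff (j : Fin n) : Continuous (scaleOff j) := by
  unfold scaleOff; fun_prop

lemma norm_scaleOff_apply_le (j : Fin n) {t : ℝ} (ht : t ∈ Icc (0 : ℝ) 1) (v : Fin n → ℝ) :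
    ‖scaleOff j t v‖ ≤ ‖v‖ := by
  refine (pi_norm_le_iff_of_nonneg (norm_nonneg _)).2 fun i => ?_
  rw [scaleOff_apply]
  split_ifs
  · exact norm_le_pi_norm v i
  · rw [norm_mul, Real.norm_of_nonneg ht.1]
    calc t * ‖v i‖ ≤ 1 * ‖v i‖ := by gcongr; exact ht.2
      _ ≤ ‖v‖ := by rw [one_mul]; exact norm_le_pi_norm v i

lemma norm_scaleOff_le (j : Fin n) {t : ℝ} (ht : t ∈ Icc (0 : ℝ) 1) : ‖scaleOff j t‖ ≤ 1 :=
  ContinuousLinearMap.opNorm_le_bound _ zero_le_one fun v => by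
    rw [one_mul]; exact norm_scaleOff_apply_le j ht v

lemma scaleOff_one (j : Fin n) (v : Fin n → ℝ) : scaleOff j 1 v = v := by
  ext i; simp [scaleOff_apply]

lemma scaleOff_single {j k : Fin n} (hkj : k ≠ j) (t : ℝ) :
    scaleOff j t (Pi.single k 1) = t • (Pi.single k 1 : Fin n → ℝ) := by
  ext i
  rw [scaleOff_apply]
  by_cases h : i = k
  · subst h; simp [hkj]
  · simp [h]

/-- The point at parameter `t` of the segment that runs to `w` from the point of the `j`-th
coordinate axis through `c` with the same `j`-th coordinate as `w`. -/
def ray (c : Fin n → ℝ) (j : Fin n) (w : Fin n → ℝ) (t : ℝ) : Fin n → ℝ :=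
  c + scaleOff j t (w - c)

lemma ray_one (j : Fin n) (w : Fin n → ℝ) : ray c j w 1 = w := by
  simp [ray, scaleOff_one]

lemma ray_zero (j : Fin n) (w : Fin n → ℝ) : ray c j w 0 = Function.update c j (w j) := by
  ext i
  by_cases h : i = j
  · subst h; simp [ray, scaleOff_apply]
  · simp [ray, scaleOff_apply, h]

lemma ray_mem_closedBall (j : Fin n) {w : Fin n → ℝ} {s : ℝ} (hw : w ∈ closedBall c s) {t : ℝ}
    (ht : t ∈ Icc (0 : ℝ) 1) : ray c j w t ∈ closedBall c s := by
  rw [mem_closedBall_iff_norm] at hw ⊢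
  simpa [ray] using (norm_scaleOff_apply_le j ht (w - c)).trans hw

lemma ray_mem_ball (j : Fin n) {w : Fin n → ℝ} (hw : w ∈ ball c r) {t : ℝ}
    (ht : t ∈ Icc (0 : ℝ) 1) : ray c j w t ∈ ball c r := by
  rw [mem_ball_iff_norm] at hw ⊢
  simpa [ray] using (norm_scaleOff_apply_le j ht (w - c)).trans_lt hw

lemma continuous_ray (j : Fin n) (w : Fin n → ℝ) : Continuous (ray c j w) := by
  unfold ray; exact continuous_const.add ((continuous_scaleOff j).clm_apply continuous_const)

lemma continuous_ray_left (j : Fin n) (t : ℝ) : Continuous fun w => ray c j w t := by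
  unfold ray; fun_prop

lemma hasFDerivAt_ray (j : Fin n) (w : Fin n → ℝ) (t : ℝ) :
    HasFDerivAt (fun w => ray c j w t) (scaleOff j t) w := by
  unfold ray
  exact ((scaleOff j t).hasFDerivAt.comp w ((hasFDerivAt_id w).sub_const c)).const_add c

lemma sub_update_eq_sum (j : Fin n) (v : Fin n → ℝ) :
    v - Pi.single j (v j) = ∑ i ∈ Finset.univ.erase j, v i • (Pi.single i 1 : Fin n → ℝ) := by
  rw [sub_eq_iff_eq_add]
  ext k
  simp only [Pi.add_apply, Finset.sum_apply, Pi.smul_apply, smul_eq_mul]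
  by_cases h : k = j
  · subst h
    rw [Finset.sum_eq_zero]
    · simp
    · intro i hi; simp [(Finset.ne_of_mem_erase hi).symm]
  · rw [Finset.sum_eq_single k]
    · simp [h]
    · intro i _ hik; simp [hik.symm]
    · intro hk; simp [h] at hk

lemma hasDerivAt_ray (j : Fin n) (w : Fin n → ℝ) (t : ℝ) :
    HasDerivAt (ray c j w)
      (∑ i ∈ Finset.univ.erase j, (w i - c i) • (Pi.single i 1 : Fin n → ℝ)) t := by
  have h : ray c j w = fun t => t • ((w - c) - Pi.single j ((w - c) j)) +
      (c + Pi.single j ((w - c) j)) := by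
    ext t i
    simp [ray, scaleOff]
    ring
  rw [h]
  have := (((hasDerivAt_id t).smul_const ((w - c) - Pi.single j ((w - c) j))).add_const
    (c + Pi.single j ((w - c) j)))
  refine this.congr_deriv ?_
  rw [one_smul, sub_update_eq_sum]
  rfl

/-- The average of `g` over the segment `ray c j w`. -/
def rayMean (c : Fin n → ℝ) (j : Fin n) (g : (Fin n → ℝ) → ℝ) (w : Fin n → ℝ) : ℝ :=
  ∫ t in (0 : ℝ)..1, g (ray c j w t)

lemma continuousOn_comp_ray {F : Type*} [TopologicalSpace F] {g : (Fin n → ℝ) → F}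
    (hg : ContinuousOn g (ball c r)) (j : Fin n) {w : Fin n → ℝ} (hw : w ∈ ball c r) :
    ContinuousOn (fun t => g (ray c j w t)) (Icc 0 1) :=
  hg.comp (continuous_ray j w).continuousOn fun _ ht => ray_mem_ball j hw ht

lemma intervalIntegrable_of_continuousOn {F : Type*} [NormedAddCommGroup F] {h : ℝ → F}
    (hh : ContinuousOn h (Icc 0 1)) : IntervalIntegrable h volume 0 1 :=
  ContinuousOn.intervalIntegrable (by rwa [uIcc_of_le zero_le_one])

lemma aestronglyMeasurable_of_continuousOn {F : Type*} [NormedAddCommGroup F] {h : ℝ → F}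
    (hh : ContinuousOn h (Icc 0 1)) : AEStronglyMeasurable h (volume.restrict (uIoc 0 1)) :=
  (intervalIntegrable_iff.1 (intervalIntegrable_of_continuousOn hh)).aestronglyMeasurable

lemma uIoc_zero_one_subset : uIoc (0 : ℝ) 1 ⊆ Icc 0 1 := by
  rw [uIoc_of_le zero_le_one]; exact Ioc_subset_Icc_self

lemma abs_integral_le_of_abs_le {h : ℝ → ℝ} {A : ℝ} (hA : ∀ t ∈ Icc (0 : ℝ) 1, |h t| ≤ A) :
    |∫ t in (0 : ℝ)..1, h t| ≤ A := by
  have := intervalIntegral.norm_integral_le_of_norm_le_const (a := 0) (b := 1) (f := h) (C := A)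
    fun t ht => hA t (uIoc_zero_one_subset ht)
  simpa using this

lemma abs_rayMean_le (j : Fin n) {g : (Fin n → ℝ) → ℝ} {A s : ℝ}
    (hA : ∀ w ∈ closedBall c s, |g w| ≤ A) {w : Fin n → ℝ} (hw : w ∈ closedBall c s) :
    |rayMean c j g w| ≤ A :=
  abs_integral_le_of_abs_le fun _ ht => hA _ (ray_mem_closedBall j hw ht)

/-! ### Functions on a ball with bounds on values and first derivatives -/

/-- `g` is `C¹` on the ball `B(c, r)`, with `|g| ≤ A` and `‖Dg‖ ≤ B` there. -/
structure C1Bound (g : (Fin n → ℝ) → ℝ) (c : Fin n → ℝ) (r A B : ℝ) : Prop where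
  contDiffOn : ContDiffOn ℝ 1 g (ball c r)
  abs_le : ∀ w ∈ ball c r, |g w| ≤ A
  norm_fderiv_le : ∀ w ∈ ball c r, ‖fderiv ℝ g w‖ ≤ B

namespace C1Bound

variable {g h : (Fin n → ℝ) → ℝ} {A B A' B' : ℝ}

lemma continuousOn (hg : C1Bound g c r A B) : ContinuousOn g (ball c r) :=
  hg.contDiffOn.continuousOn

lemma differentiableAt (hg : C1Bound g c r A B) {w : Fin n → ℝ} (hw : w ∈ ball c r) :
    DifferentiableAt ℝ g w :=
  (hg.contDiffOn.differentiableOn one_ne_zero).differentiableAt (isOpen_ball.mem_nhds hw)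

lemma hasFDerivAt (hg : C1Bound g c r A B) {w : Fin n → ℝ} (hw : w ∈ ball c r) :
    HasFDerivAt g (fderiv ℝ g w) w :=
  (hg.differentiableAt hw).hasFDerivAt

lemma continuousOn_fderiv (hg : C1Bound g c r A B) : ContinuousOn (fderiv ℝ g) (ball c r) :=
  hg.contDiffOn.continuousOn_fderiv_of_isOpen isOpen_ball le_rfl

lemma of_hasFDerivAt {g' : (Fin n → ℝ) → (Fin n → ℝ) →L[ℝ] ℝ}
    (hd : ∀ w ∈ ball c r, HasFDerivAt g (g' w) w) (hc : ContinuousOn g' (ball c r))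
    (hA : ∀ w ∈ ball c r, |g w| ≤ A) (hB : ∀ w ∈ ball c r, ‖g' w‖ ≤ B) :
    C1Bound g c r A B := by
  refine ⟨?_, hA, fun w hw => by rw [(hd w hw).fderiv]; exact hB w hw⟩
  rw [show (1 : WithTop ℕ∞) = 0 + 1 from rfl, contDiffOn_succ_iff_fderiv_of_isOpen isOpen_ball]
  refine ⟨fun w hw => (hd w hw).differentiableAt.differentiableWithinAt, by simp, ?_⟩
  rw [contDiffOn_zero]
  exact hc.congr fun w hw => (hd w hw).fderiv

lemma mono (hg : C1Bound g c r A B) (hA : A ≤ A') (hB : B ≤ B') : C1Bound g c r A' B' :=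
  ⟨hg.contDiffOn, fun w hw => (hg.abs_le w hw).trans hA,
    fun w hw => (hg.norm_fderiv_le w hw).trans hB⟩

lemma add (hg : C1Bound g c r A B) (hh : C1Bound h c r A' B') :
    C1Bound (fun w => g w + h w) c r (A + A') (B + B') := by
  refine ⟨hg.contDiffOn.add hh.contDiffOn, fun w hw => ?_, fun w hw => ?_⟩
  · exact (abs_add_le _ _).trans (add_le_add (hg.abs_le w hw) (hh.abs_le w hw))
  · rw [fderiv_fun_add (hg.differentiableAt hw) (hh.differentiableAt hw)]
    exact (norm_add_le _ _).trans (add_le_add (hg.norm_fderiv_le w hw) (hh.norm_fderiv_le w hw))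

lemma mul (hg : C1Bound g c r A B) (hh : C1Bound h c r A' B') :
    C1Bound (fun w => g w * h w) c r (A * A') (A * B' + A' * B) := by
  refine ⟨hg.contDiffOn.mul hh.contDiffOn, fun w hw => ?_, fun w hw => ?_⟩
  · rw [abs_mul]
    exact mul_le_mul (hg.abs_le w hw) (hh.abs_le w hw) (abs_nonneg _)
      ((abs_nonneg _).trans (hg.abs_le w hw))
  · rw [fderiv_fun_mul (hg.differentiableAt hw) (hh.differentiableAt hw)]
    refine (norm_add_le _ _).trans (add_le_add ?_ ?_)
    · rw [norm_smul]
      exact mul_le_mul (hg.abs_le w hw) (hh.norm_fderiv_le w hw) (norm_nonneg _)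
        ((abs_nonneg _).trans (hg.abs_le w hw))
    · rw [norm_smul]
      exact mul_le_mul (hh.abs_le w hw) (hg.norm_fderiv_le w hw) (norm_nonneg _)
        ((abs_nonneg _).trans (hh.abs_le w hw))

lemma sum {ι : Type*} (s : Finset ι) {g : ι → (Fin n → ℝ) → ℝ} {A B : ι → ℝ}
    (hg : ∀ i ∈ s, C1Bound (g i) c r (A i) (B i)) :
    C1Bound (fun w => ∑ i ∈ s, g i w) c r (∑ i ∈ s, A i) (∑ i ∈ s, B i) := by
  classical
  induction s using Finset.induction_on with
  | empty =>
    simp only [Finset.sum_empty]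
    exact ⟨contDiffOn_const, by simp, by simp⟩
  | insert a s ha ih =>
    simp only [Finset.sum_insert ha]
    exact (hg a (by simp)).add (ih fun i hi => hg i (by simp [hi]))

lemma coord_sub (i : Fin n) : C1Bound (fun w => w i - c i) c r r 1 := by
  have hd : ∀ w : Fin n → ℝ, HasFDerivAt (fun w : Fin n → ℝ => w i - c i)
      (ContinuousLinearMap.proj (R := ℝ) (φ := fun _ : Fin n => ℝ) i) w := fun w =>
    ((ContinuousLinearMap.proj (R := ℝ) (φ := fun _ : Fin n => ℝ) i).hasFDerivAt).sub_const (c i)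
  refine of_hasFDerivAt (fun w _ => hd w) continuousOn_const (fun w hw => ?_) (fun w _ => ?_)
  · rw [mem_ball_iff_norm] at hw
    exact (norm_le_pi_norm (w - c) i).trans hw.le
  · refine ContinuousLinearMap.opNorm_le_bound _ zero_le_one fun v => ?_
    rw [one_mul]; exact norm_le_pi_norm v i

/-- The sum of a series of `C¹` functions with summable `C¹` bounds. -/
lemma tsum {g : ℕ → (Fin n → ℝ) → ℝ} {A B : ℕ → ℝ} (hg : ∀ m, C1Bound (g m) c r (A m) (B m))
    (hA : Summable A) (hB : Summable B) :
    C1Bound (fun w => ∑' m, g m w) c r (∑' m, A m) (∑' m, B m) := by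
  have hs : ∀ w ∈ ball c r, Summable fun m => g m w := fun w hw =>
    Summable.of_norm_bounded hA fun m => (hg m).abs_le w hw
  refine of_hasFDerivAt (g' := fun w => ∑' m, fderiv ℝ (g m) w) (fun w hw => ?_) ?_ ?_ ?_
  · exact hasFDerivAt_tsum_of_isPreconnected hB isOpen_ball (convex_ball c r).isPreconnected
      (fun m x hx => (hg m).hasFDerivAt hx) (fun m x hx => (hg m).norm_fderiv_le x hx) hw (hs w hw)
      hw
  · exact continuousOn_tsum (fun m => (hg m).continuousOn_fderiv) hB
      fun m x hx => (hg m).norm_fderiv_le x hx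
  · intro w hw
    rw [← Real.norm_eq_abs]
    exact tsum_of_norm_bounded hA.hasSum fun m => (hg m).abs_le w hw
  · exact fun w hw => tsum_of_norm_bounded hB.hasSum fun m => (hg m).norm_fderiv_le w hw

lemma continuousOn_fderiv_ray (hg : C1Bound g c r A B) (j : Fin n) {w : Fin n → ℝ}
    (hw : w ∈ ball c r) :
    ContinuousOn (fun t => (fderiv ℝ g (ray c j w t)).comp (scaleOff j t)) (Icc 0 1) :=
  (continuousOn_comp_ray hg.continuousOn_fderiv j hw).clm_comp (continuous_scaleOff j).continuousOn

lemma norm_fderiv_ray_le (hg : C1Bound g c r A B) (j : Fin n) {w : Fin n → ℝ}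
    (hw : w ∈ ball c r) {t : ℝ} (ht : t ∈ Icc (0 : ℝ) 1) :
    ‖(fderiv ℝ g (ray c j w t)).comp (scaleOff j t)‖ ≤ B := by
  have h1 := hg.norm_fderiv_le _ (ray_mem_ball j hw ht)
  calc _ ≤ ‖fderiv ℝ g (ray c j w t)‖ * ‖scaleOff j t‖ := ContinuousLinearMap.opNorm_comp_le _ _
    _ ≤ B * 1 := mul_le_mul h1 (norm_scaleOff_le j ht) (norm_nonneg _) ((norm_nonneg _).trans h1)
    _ = B := mul_one B

lemma hasFDerivAt_rayMean (hg : C1Bound g c r A B) (j : Fin n) {w : Fin n → ℝ}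
    (hw : w ∈ ball c r) :
    HasFDerivAt (rayMean c j g)
      (∫ t in (0 : ℝ)..1, (fderiv ℝ g (ray c j w t)).comp (scaleOff j t)) w := by
  refine intervalIntegral.hasFDerivAt_integral_of_dominated_of_fderiv_le (bound := fun _ => B)
    (F' := fun w t => (fderiv ℝ g (ray c j w t)).comp (scaleOff j t))
    (isOpen_ball.mem_nhds hw) ?_ ?_ ?_ ?_ ?_ ?_
  · filter_upwards [isOpen_ball.mem_nhds hw] with x hx
    exact aestronglyMeasurable_of_continuousOn (continuousOn_comp_ray hg.continuousOn j hx)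
  · exact intervalIntegrable_of_continuousOn (continuousOn_comp_ray hg.continuousOn j hw)
  · exact aestronglyMeasurable_of_continuousOn (hg.continuousOn_fderiv_ray j hw)
  · exact .of_forall fun t ht x hx => hg.norm_fderiv_ray_le j hx (uIoc_zero_one_subset ht)
  · exact intervalIntegrable_const
  · exact .of_forall fun t ht x hx =>
      (hg.hasFDerivAt (ray_mem_ball j hx (uIoc_zero_one_subset ht))).comp x (hasFDerivAt_ray j x t)

/-- Averaging over the segments preserves `C¹` bounds, as the segments depend on their endpoint
by maps of norm at most one. -/
lemma rayMean (hg : C1Bound g c r A B) (j : Fin n) : C1Bound (rayMean c j g) c r A B := by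
  refine of_hasFDerivAt (fun w hw => hg.hasFDerivAt_rayMean j hw) ?_ ?_ ?_
  · intro w hw
    refine intervalIntegral.continuousWithinAt_of_dominated_interval (bound := fun _ => B)
      ?_ ?_ intervalIntegrable_const ?_
    · filter_upwards [self_mem_nhdsWithin] with x hx
      exact aestronglyMeasurable_of_continuousOn (hg.continuousOn_fderiv_ray j hx)
    · filter_upwards [self_mem_nhdsWithin] with x hx
      exact .of_forall fun t ht => hg.norm_fderiv_ray_le j hx (uIoc_zero_one_subset ht)
    · refine .of_forall fun t ht => ?_
      have : ContinuousOn (fun x => (fderiv ℝ g (ray c j x t)).comp (scaleOff j t)) (ball c r) :=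
        (hg.continuousOn_fderiv.comp (continuous_ray_left j t).continuousOn
          fun x hx => ray_mem_ball j hx (uIoc_zero_one_subset ht)).clm_comp continuousOn_const
      exact this w hw
  · exact fun w hw => abs_integral_le_of_abs_le fun t ht => hg.abs_le _ (ray_mem_ball j hw ht)
  · intro w hw
    have := intervalIntegral.norm_integral_le_of_norm_le_const (a := 0) (b := 1) (C := B)
      (f := fun t => (fderiv ℝ g (ray c j w t)).comp (scaleOff j t))
      fun t ht => hg.norm_fderiv_ray_le j hw (uIoc_zero_one_subset ht)
    simpa using this

lemma continuousOn_fderiv_ray_apply (hg : C1Bound g c r A B) (j : Fin n) (v : Fin n → ℝ)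
    {w : Fin n → ℝ} (hw : w ∈ ball c r) :
    ContinuousOn (fun t => fderiv ℝ g (ray c j w t) v) (Icc 0 1) :=
  (continuousOn_comp_ray hg.continuousOn_fderiv j hw).clm_apply continuousOn_const

lemma fderiv_rayMean_single (hg : C1Bound g c r A B) {j k : Fin n} (hkj : k ≠ j)
    {w : Fin n → ℝ} (hw : w ∈ ball c r) :
    fderiv ℝ (DarbouxSystem.rayMean c j g) w (Pi.single k 1) =
      ∫ t in (0 : ℝ)..1, t * fderiv ℝ g (ray c j w t) (Pi.single k 1) := by
  rw [(hg.hasFDerivAt_rayMean j hw).fderiv, ContinuousLinearMap.intervalIntegral_apply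
    (intervalIntegrable_of_continuousOn (hg.continuousOn_fderiv_ray j hw))]
  refine intervalIntegral.integral_congr fun t _ => ?_
  simp [scaleOff_single hkj]

lemma hasDerivAt_comp_ray (hg : C1Bound g c r A B) (j : Fin n) {w : Fin n → ℝ}
    (hw : w ∈ ball c r) {t : ℝ} (ht : t ∈ Icc (0 : ℝ) 1) :
    HasDerivAt (fun t => g (ray c j w t))
      (∑ i ∈ Finset.univ.erase j, (w i - c i) * fderiv ℝ g (ray c j w t) (Pi.single i 1)) t := by
  have := (hg.hasFDerivAt (ray_mem_ball j hw ht)).comp_hasDerivAt t (hasDerivAt_ray j w t)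
  refine this.congr_deriv ?_
  simp only [map_sum, map_smul, smul_eq_mul]

/-- The fundamental theorem of calculus for `t ↦ g (ray t)`. -/
lemma eq_add_sum_rayMean (hg : C1Bound g c r A B) (j : Fin n) {w : Fin n → ℝ}
    (hw : w ∈ ball c r) :
    g w = g (Function.update c j (w j)) + ∑ i ∈ Finset.univ.erase j, (w i - c i) *
      DarbouxSystem.rayMean c j (fun x => fderiv ℝ g x (Pi.single i 1)) w := by
  have hc : ∀ i, ContinuousOn (fun t => (w i - c i) * fderiv ℝ g (ray c j w t) (Pi.single i 1))
      (Icc 0 1) := fun i =>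
    continuousOn_const.mul (hg.continuousOn_fderiv_ray_apply j _ hw)
  have h := intervalIntegral.integral_eq_sub_of_hasDerivAt (a := 0) (b := 1)
    (fun t ht => hg.hasDerivAt_comp_ray j hw (by rwa [uIcc_of_le zero_le_one] at ht))
    (intervalIntegrable_of_continuousOn (continuousOn_finsetSum _ fun i _ => hc i))
  rw [ray_one, ray_zero, intervalIntegral.integral_finsetSum
    fun i _ => intervalIntegrable_of_continuousOn (hc i)] at h
  simp only [intervalIntegral.integral_const_mul] at h
  rw [eq_comm, sub_eq_iff_eq_add'] at h
  exact h

/-- The fundamental theorem of calculus for `t ↦ t * g (ray t)`. -/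
lemma eq_rayMean_add_sum (hg : C1Bound g c r A B) (j : Fin n) {w : Fin n → ℝ}
    (hw : w ∈ ball c r) :
    g w = DarbouxSystem.rayMean c j g w + ∑ i ∈ Finset.univ.erase j, (w i - c i) *
      ∫ t in (0 : ℝ)..1, t * fderiv ℝ g (ray c j w t) (Pi.single i 1) := by
  have hc : ∀ i, ContinuousOn
      (fun t => (w i - c i) * (t * fderiv ℝ g (ray c j w t) (Pi.single i 1)))
      (Icc 0 1) := fun i =>
    continuousOn_const.mul (continuousOn_id.mul (hg.continuousOn_fderiv_ray_apply j _ hw))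
  have h0 : ContinuousOn (fun t => g (ray c j w t)) (Icc 0 1) :=
    continuousOn_comp_ray hg.continuousOn j hw
  have hS := intervalIntegrable_of_continuousOn (continuousOn_finsetSum (Finset.univ.erase j)
    fun i _ => hc i)
  have h := intervalIntegral.integral_eq_sub_of_hasDerivAt (a := 0) (b := 1)
    (f := fun t => t * g (ray c j w t))
    (f' := fun t => g (ray c j w t) + ∑ i ∈ Finset.univ.erase j,
      (w i - c i) * (t * fderiv ℝ g (ray c j w t) (Pi.single i 1)))
    (fun t ht => by
      have := (hasDerivAt_id t).mul
        (hg.hasDerivAt_comp_ray j hw (t := t) (by rwa [uIcc_of_le zero_le_one] at ht))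
      refine this.congr_deriv ?_
      rw [id, one_mul, Finset.mul_sum]
      congr 1
      exact Finset.sum_congr rfl fun i _ => by ring)
    ((intervalIntegrable_of_continuousOn h0).add hS)
  rw [ray_one, intervalIntegral.integral_add (intervalIntegrable_of_continuousOn h0) hS,
    intervalIntegral.integral_finsetSum
    fun i _ => intervalIntegrable_of_continuousOn (hc i)] at h
  simp only [intervalIntegral.integral_const_mul] at h
  simp only [one_mul, zero_mul, sub_zero] at h
  exact h.symm

end C1Bound

/-- A continuous function whose supremum over each closed ball inside `B(c, r)` is at most half
of itself vanishes on `B(c, r)`. -/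
lemma eq_zero_of_norm_le_half {F : Type*} [NormedAddCommGroup F] {g : (Fin n → ℝ) → F}
    (hg : ContinuousOn g (ball c r))
    (h : ∀ s < r, ∀ S, (∀ w ∈ closedBall c s, ‖g w‖ ≤ S) → ∀ w ∈ closedBall c s, ‖g w‖ ≤ S / 2)
    {w : Fin n → ℝ} (hw : w ∈ ball c r) : g w = 0 := by
  have hs : dist w c < r := hw
  obtain ⟨p, hp, hmax⟩ := (isCompact_closedBall c (dist w c)).exists_isMaxOn
    ⟨w, mem_closedBall.2 le_rfl⟩ (hg.mono (closedBall_subset_ball hs)).norm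
  have h1 := h _ hs ‖g p‖ (fun x hx => hmax hx)
  have h2 := h1 p hp
  have h3 := h1 w (mem_closedBall.2 le_rfl)
  have h4 : ‖g p‖ = 0 := le_antisymm (by linarith) (norm_nonneg _)
  rw [h4] at h3
  exact norm_le_zero_iff.1 (by linarith)

namespace C1Bound

variable {g : (Fin n → ℝ) → ℝ} {A B : ℝ}

lemma eventually_of_contDiffAt (hg : ContDiffAt ℝ 1 g c) :
    ∃ A, ∀ᶠ r in 𝓝[>] (0 : ℝ), C1Bound g c r A A := by
  have h1 : ∀ᶠ w in 𝓝 c, ContDiffAt ℝ 1 g w := hg.eventually (by simp)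
  have h2 : ∀ᶠ w in 𝓝 c, |g w| < |g c| + 1 :=
    hg.continuousAt.abs.eventually (gt_mem_nhds (lt_add_one _))
  have h3 : ∀ᶠ w in 𝓝 c, ‖fderiv ℝ g w‖ < ‖fderiv ℝ g c‖ + 1 :=
    (hg.fderiv_right (m := 0) le_rfl).continuousAt.norm.eventually (gt_mem_nhds (lt_add_one _))
  obtain ⟨ε, hε, h⟩ := Metric.eventually_nhds_iff_ball.1 (h1.and (h2.and h3))
  refine ⟨max (|g c| + 1) (‖fderiv ℝ g c‖ + 1), ?_⟩
  filter_upwards [Ioo_mem_nhdsGT hε] with r hr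
  have hb : ball c r ⊆ ball c ε := ball_subset_ball hr.2.le
  exact ⟨fun w hw => (h w (hb hw)).1.contDiffWithinAt,
    fun w hw => (h w (hb hw)).2.1.le.trans (le_max_left _ _),
    fun w hw => (h w (hb hw)).2.2.le.trans (le_max_right _ _)⟩

lemma mono_ball (hg : C1Bound g c r A B) {s : ℝ} (hs : s ≤ r) : C1Bound g c s A B :=
  ⟨hg.contDiffOn.mono (ball_subset_ball hs), fun w hw => hg.abs_le w (ball_subset_ball hs hw),
    fun w hw => hg.norm_fderiv_le w (ball_subset_ball hs hw)⟩

lemma exists_of_contDiffOn (hg : ContDiffOn ℝ 1 g (ball c r)) {s : ℝ} (hs : s < r) :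
    ∃ A B, C1Bound g c s A B := by
  have hsub : closedBall c s ⊆ ball c r := closedBall_subset_ball hs
  obtain ⟨A, hA⟩ := (isCompact_closedBall c s).exists_bound_of_continuousOn
    (hg.continuousOn.mono hsub)
  obtain ⟨B, hB⟩ := (isCompact_closedBall c s).exists_bound_of_continuousOn
    ((hg.continuousOn_fderiv_of_isOpen isOpen_ball le_rfl).mono hsub)
  exact ⟨A, B, hg.mono (ball_subset_ball hs.le), fun w hw => hA w (ball_subset_closedBall hw),
    fun w hw => hB w (ball_subset_closedBall hw)⟩

end C1Bound

/-! ### Picard iteration for linear Darboux systems -/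

/-- The prescribed value `a_{ij} γ^j + b_{ij} γ^i` of `∂_i γ^j` in a linear Darboux system. -/
def rhs (a b : Fin n → Fin n → (Fin n → ℝ) → ℝ) (γ : (Fin n → ℝ) → (Fin n → ℝ)) (i j : Fin n)
    (w : Fin n → ℝ) : ℝ :=
  a i j w * γ w j + b i j w * γ w i

/-- The integral operator of a linear Darboux system: the `j`-th component at `w` is the integral
of the prescribed derivatives of `γ^j` along the segment from the `j`-th axis to `w`. -/
def picard (a b : Fin n → Fin n → (Fin n → ℝ) → ℝ) (c : Fin n → ℝ)
    (γ : (Fin n → ℝ) → (Fin n → ℝ)) (w : Fin n → ℝ) : Fin n → ℝ :=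
  fun j => ∑ i ∈ Finset.univ.erase j, (w i - c i) * rayMean c j (rhs a b γ i j) w

/-- The coefficients are `C¹` on `B(c, r)`, bounded with their first derivatives by `M`, and `r` is
so small that `picard` is a contraction there. -/
structure SmallCoeffs (a b : Fin n → Fin n → (Fin n → ℝ) → ℝ) (c : Fin n → ℝ) (r M : ℝ) :
    Prop where
  left : ∀ i j, i ≠ j → C1Bound (a i j) c r M M
  right : ∀ i j, i ≠ j → C1Bound (b i j) c r M M
  pos : 0 < r
  nonneg : 0 ≤ M
  small : 8 * n * M * r ≤ 1

variable {a b : Fin n → Fin n → (Fin n → ℝ) → ℝ} {M : ℝ} {γ : (Fin n → ℝ) → (Fin n → ℝ)}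
  {A B : ℝ}

lemma sum_erase_const_le (j : Fin n) {x : ℝ} (hx : 0 ≤ x) :
    ∑ _i ∈ Finset.univ.erase j, x ≤ n * x := by
  rw [Finset.sum_const, nsmul_eq_mul]
  gcongr
  exact (Finset.card_le_univ _).trans_eq (Fintype.card_fin n)

lemma SmallCoeffs.rhs (h : SmallCoeffs a b c r M) (hγ : ∀ j, C1Bound (fun w => γ w j) c r A B)
    {i j : Fin n} (hij : i ≠ j) :
    C1Bound (rhs a b γ i j) c r (2 * M * A) (2 * M * (A + B)) :=
  (((h.left i j hij).mul (hγ j)).add ((h.right i j hij).mul (hγ i))).mono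
    (by linarith) (by linarith)

/-- The weight `8nM + 1` between values and derivatives makes `picard` a contraction by the factor
`1/2` for the `C¹` bounds. -/
lemma SmallCoeffs.picard (h : SmallCoeffs a b c r M) (hA : 0 ≤ A)
    (hγ : ∀ j, C1Bound (fun w => γ w j) c r A ((8 * n * M + 1) * A)) (j : Fin n) :
    C1Bound (fun w => picard a b c γ w j) c r (A / 2) ((8 * n * M + 1) * (A / 2)) := by
  have hM := h.nonneg
  have hr := h.pos.le
  have hs := h.small
  have hB : 0 ≤ (8 * n * M + 1) * A := by positivity
  have h1 := C1Bound.sum (Finset.univ.erase j) fun i hi =>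
    (C1Bound.coord_sub (c := c) (r := r) i).mul
      ((h.rhs hγ (Finset.ne_of_mem_erase hi)).rayMean j)
  refine h1.mono ((sum_erase_const_le j (by positivity)).trans ?_)
    ((sum_erase_const_le j (by positivity)).trans ?_)
  · nlinarith [mul_le_mul_of_nonneg_right hs hA]
  · have h2 := mul_le_mul_of_nonneg_right hs hA
    have h3 := mul_le_mul_of_nonneg_right hs hB
    nlinarith

lemma rayMean_hasSum (j : Fin n) {g : ℕ → (Fin n → ℝ) → ℝ} {G : (Fin n → ℝ) → ℝ} {A B : ℕ → ℝ}
    (hg : ∀ m, C1Bound (g m) c r (A m) (B m)) (hA : Summable A)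
    (hG : ∀ w ∈ ball c r, HasSum (fun m => g m w) (G w)) {w : Fin n → ℝ} (hw : w ∈ ball c r) :
    HasSum (fun m => rayMean c j (g m) w) (rayMean c j G w) := by
  refine intervalIntegral.hasSum_integral_of_dominated_convergence (fun m _ => A m) ?_ ?_ ?_ ?_ ?_
  · exact fun m => aestronglyMeasurable_of_continuousOn
      (continuousOn_comp_ray (hg m).continuousOn j hw)
  · exact fun m => .of_forall fun t ht =>
      (hg m).abs_le _ (ray_mem_ball j hw (uIoc_zero_one_subset ht))
  · exact .of_forall fun _ _ => hA
  · exact intervalIntegrable_const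
  · exact .of_forall fun t ht => hG _ (ray_mem_ball j hw (uIoc_zero_one_subset ht))

/-- The series of Picard iterates solves the integral equation of the Darboux system. -/
theorem SmallCoeffs.exists_eq_add_picard (h : SmallCoeffs a b c r M)
    {f : (Fin n → ℝ) → (Fin n → ℝ)} {K : ℝ} (hK : 0 ≤ K)
    (hf : ∀ j, C1Bound (fun w => f w j) c r K K) :
    ∃ γ : (Fin n → ℝ) → (Fin n → ℝ), ∃ A B : ℝ, (∀ j, C1Bound (fun w => γ w j) c r A B) ∧
      ∀ w ∈ ball c r, ∀ j, γ w j = f w j + DarbouxSystem.picard a b c γ w j := by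
  set Q : ℝ := 8 * n * M + 1 with hQ
  have hM := h.nonneg
  have hQ1 : 1 ≤ Q := by rw [hQ]; linarith [show 0 ≤ 8 * n * M by positivity]
  obtain ⟨g, hg0, hgs⟩ : ∃ g : ℕ → (Fin n → ℝ) → (Fin n → ℝ), g 0 = f ∧
      ∀ m, g (m + 1) = DarbouxSystem.picard a b c (g m) :=
    ⟨fun m => (DarbouxSystem.picard a b c)^[m] f, rfl,
      fun m => Function.iterate_succ_apply' _ _ _⟩
  have hg : ∀ m j, C1Bound (fun w => g m w j) c r (K * (1 / 2) ^ m) (Q * (K * (1 / 2) ^ m)) := by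
    intro m
    induction m with
    | zero =>
      intro j
      rw [hg0]
      exact (hf j).mono (by simp) (by simpa using le_mul_of_one_le_left hK hQ1)
    | succ m ih =>
      intro j
      rw [hgs]
      exact (h.picard (by positivity) ih j).mono (le_of_eq (by rw [pow_succ]; ring))
        (le_of_eq (by rw [pow_succ]; ring))
  have hS : Summable fun m : ℕ => K * (1 / 2) ^ m :=
    summable_geometric_two.mul_left K
  have hγ := fun j => C1Bound.tsum (fun m => hg m j) hS (hS.mul_left Q)
  let γ : (Fin n → ℝ) → (Fin n → ℝ) := fun w j => ∑' m, g m w j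
  have hsum : ∀ w ∈ ball c r, ∀ j, HasSum (fun m => g m w j) (γ w j) := fun w hw j =>
    (Summable.of_norm_bounded hS fun m => (hg m j).abs_le w hw).hasSum
  refine ⟨γ, _, _, hγ, fun w hw j => ?_⟩
  have hP : HasSum (fun m => g (m + 1) w j) (DarbouxSystem.picard a b c γ w j) := by
    simp only [hgs]
    refine hasSum_sum fun i hi => ?_
    refine HasSum.mul_left _ (rayMean_hasSum j
      (fun m => h.rhs (hg m) (Finset.ne_of_mem_erase hi)) (hS.mul_left _) (fun x hx => ?_) hw)
    exact ((hsum x hx j).mul_left _).add ((hsum x hx i).mul_left _)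
  have := (hasSum_nat_add_iff (f := fun m => g m w j) 1).1 hP
  rw [Finset.sum_range_one, hg0] at this
  rw [(hsum w hw j).unique this, add_comm]

/-! ### Solutions of linear Darboux systems -/

/-- The compatibility conditions `∂_k ∂_i γ^j = ∂_i ∂_k γ^j` of a linear Darboux system. -/
def CompatibleAt (a b : Fin n → Fin n → (Fin n → ℝ) → ℝ) (w : Fin n → ℝ) : Prop :=
  ∀ i j k : Fin n, i ≠ j → j ≠ k → i ≠ k →
    fderiv ℝ (a i j) w (Pi.single k 1) = fderiv ℝ (a k j) w (Pi.single i 1) ∧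
    fderiv ℝ (b k j) w (Pi.single i 1) =
      a i j w * b k j w + b i j w * b k i w - a i k w * b k j w

/-- The failure of `γ` to satisfy the equation for `∂_i γ^j`. -/
def defect (a b : Fin n → Fin n → (Fin n → ℝ) → ℝ) (γ : (Fin n → ℝ) → (Fin n → ℝ))
    (w : Fin n → ℝ) : Fin n → Fin n → ℝ :=
  fun i j => if i = j then 0 else
    fderiv ℝ (fun x => γ x j) w (Pi.single i 1) - rhs a b γ i j w

lemma defect_of_ne {i j : Fin n} (hij : i ≠ j) (w : Fin n → ℝ) :
    defect a b γ w i j = fderiv ℝ (fun x => γ x j) w (Pi.single i 1) - rhs a b γ i j w :=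
  if_neg hij

lemma SmallCoeffs.fderiv_rhs (h : SmallCoeffs a b c r M)
    (hγ : ∀ j, C1Bound (fun w => γ w j) c r A B) {i j : Fin n} (hij : i ≠ j) {w : Fin n → ℝ}
    (hw : w ∈ ball c r) (v : Fin n → ℝ) :
    fderiv ℝ (DarbouxSystem.rhs a b γ i j) w v =
      fderiv ℝ (a i j) w v * γ w j + a i j w * fderiv ℝ (fun x => γ x j) w v +
      (fderiv ℝ (b i j) w v * γ w i + b i j w * fderiv ℝ (fun x => γ x i) w v) := by
  have := (((h.left i j hij).hasFDerivAt hw).mul ((hγ j).hasFDerivAt hw)).add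
    (((h.right i j hij).hasFDerivAt hw).mul ((hγ i).hasFDerivAt hw))
  rw [show DarbouxSystem.rhs a b γ i j = (a i j * fun x => γ x j) + (b i j * fun x => γ x i)
    from rfl, this.fderiv]
  simp
  ring

/-- By the compatibility conditions, the mixed derivatives of the prescribed values differ by a
linear combination of defects. -/
lemma SmallCoeffs.fderiv_rhs_sub (h : SmallCoeffs a b c r M)
    (hγ : ∀ j, C1Bound (fun w => γ w j) c r A B) {i j k : Fin n} (hij : i ≠ j) (hkj : k ≠ j)
    (hik : i ≠ k) {w : Fin n → ℝ} (hw : w ∈ ball c r) (hc : CompatibleAt a b w) :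
    fderiv ℝ (DarbouxSystem.rhs a b γ i j) w (Pi.single k 1) -
      fderiv ℝ (DarbouxSystem.rhs a b γ k j) w (Pi.single i 1) =
    a i j w * defect a b γ w k j + b i j w * defect a b γ w k i -
      a k j w * defect a b γ w i j - b k j w * defect a b γ w i k := by
  rw [h.fderiv_rhs hγ hij hw, h.fderiv_rhs hγ hkj hw, defect_of_ne hkj, defect_of_ne hik.symm,
    defect_of_ne hij, defect_of_ne hik]
  obtain ⟨h1, h2⟩ := hc i j k hij hkj.symm hik
  obtain ⟨-, h3⟩ := hc k j i hkj hij.symm hik.symm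
  simp only [DarbouxSystem.rhs]
  linear_combination γ w j * h1 - γ w k * h2 + γ w i * h3

lemma SmallCoeffs.fderiv_picard (h : SmallCoeffs a b c r M)
    (hγ : ∀ j, C1Bound (fun w => γ w j) c r A B) {k j : Fin n} (hkj : k ≠ j) {w : Fin n → ℝ}
    (hw : w ∈ ball c r) :
    fderiv ℝ (fun x => DarbouxSystem.picard a b c γ x j) w (Pi.single k 1) =
      rayMean c j (DarbouxSystem.rhs a b γ k j) w + ∑ i ∈ Finset.univ.erase j, (w i - c i) *
        ∫ t in (0 : ℝ)..1,
          t * fderiv ℝ (DarbouxSystem.rhs a b γ i j) (ray c j w t) (Pi.single k 1) := by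
  have hd : ∀ i ∈ Finset.univ.erase j, HasFDerivAt
      (fun x : Fin n → ℝ => (x i - c i) * rayMean c j (DarbouxSystem.rhs a b γ i j) x)
      ((w i - c i) • fderiv ℝ (rayMean c j (DarbouxSystem.rhs a b γ i j)) w +
        rayMean c j (DarbouxSystem.rhs a b γ i j) w •
          ContinuousLinearMap.proj (R := ℝ) (φ := fun _ : Fin n => ℝ) i) w := fun i hi =>
    (((ContinuousLinearMap.proj (R := ℝ) (φ := fun _ : Fin n => ℝ) i).hasFDerivAt).sub_const
      (c i)).mul (((h.rhs hγ (Finset.ne_of_mem_erase hi)).rayMean j).hasFDerivAt hw)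
  rw [show (fun x => DarbouxSystem.picard a b c γ x j) = fun x => ∑ i ∈ Finset.univ.erase j,
    (x i - c i) * rayMean c j (DarbouxSystem.rhs a b γ i j) x from rfl,
    (HasFDerivAt.fun_sum hd).fderiv, sum_apply]
  simp only [add_apply, smul_apply, smul_eq_mul,
    ContinuousLinearMap.proj_apply]
  rw [Finset.sum_add_distrib, add_comm]
  congr 1
  · rw [Finset.sum_eq_single k]
    · simp
    · intro i _ hik; simp [hik]
    · intro hk; simp [hkj] at hk
  · refine Finset.sum_congr rfl fun i hi => ?_
    rw [(h.rhs hγ (Finset.ne_of_mem_erase hi)).fderiv_rayMean_single hkj hw]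

/-- A `C¹` solution of the integral equation solves the Darboux system: the defect satisfies a
homogeneous linear integral equation. -/
theorem SmallCoeffs.defect_eq_zero (h : SmallCoeffs a b c r M)
    (hγ : ∀ j, C1Bound (fun w => γ w j) c r A B)
    (hc : ∀ w ∈ ball c r, CompatibleAt a b w)
    {f : (Fin n → ℝ) → (Fin n → ℝ)} {K : ℝ} (hf : ∀ j, C1Bound (fun w => f w j) c r K K)
    (hf0 : ∀ w ∈ ball c r, ∀ k j, k ≠ j → fderiv ℝ (fun x => f x j) w (Pi.single k 1) = 0)
    (hfix : ∀ w ∈ ball c r, ∀ j, γ w j = f w j + DarbouxSystem.picard a b c γ w j)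
    {w : Fin n → ℝ} (hw : w ∈ ball c r) : defect a b γ w = 0 := by
  have hM := h.nonneg
  -- Differentiate the integral equation in direction `k` and subtract the fundamental theorem of
  -- calculus for `t ↦ t * rhs k j (ray t)`.
  have key : ∀ w ∈ ball c r, ∀ k j, k ≠ j → defect a b γ w k j =
      ∑ i ∈ Finset.univ.erase j, (w i - c i) * ∫ t in (0 : ℝ)..1,
        t * (fderiv ℝ (DarbouxSystem.rhs a b γ i j) (ray c j w t) (Pi.single k 1) -
          fderiv ℝ (DarbouxSystem.rhs a b γ k j) (ray c j w t) (Pi.single i 1)) := by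
    intro w hw k j hkj
    have hP : DifferentiableAt ℝ (fun x => DarbouxSystem.picard a b c γ x j) w := by
      have : (fun x => DarbouxSystem.picard a b c γ x j) =ᶠ[𝓝 w] fun x => γ x j - f x j := by
        filter_upwards [isOpen_ball.mem_nhds hw] with x hx
        rw [hfix x hx j]; ring
      exact (((hγ j).differentiableAt hw).sub ((hf j).differentiableAt hw)).congr_of_eventuallyEq
        this
    have he : (fun x => γ x j) =ᶠ[𝓝 w] fun x => f x j + DarbouxSystem.picard a b c γ x j := by
      filter_upwards [isOpen_ball.mem_nhds hw] with x hx using hfix x hx j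
    rw [defect_of_ne hkj, he.fderiv_eq, fderiv_fun_add ((hf j).differentiableAt hw) hP,
      add_apply, hf0 w hw k j hkj, h.fderiv_picard hγ hkj hw,
      (h.rhs hγ hkj).eq_rayMean_add_sum j hw, zero_add, add_sub_add_left_eq_sub,
      ← Finset.sum_sub_distrib]
    refine Finset.sum_congr rfl fun i hi => ?_
    rw [← mul_sub, ← intervalIntegral.integral_sub]
    · simp only [mul_sub]
    · exact intervalIntegrable_of_continuousOn (continuousOn_id.mul
        ((h.rhs hγ (Finset.ne_of_mem_erase hi)).continuousOn_fderiv_ray_apply j _ hw))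
    · exact intervalIntegrable_of_continuousOn (continuousOn_id.mul
        ((h.rhs hγ hkj).continuousOn_fderiv_ray_apply j _ hw))
  refine eq_zero_of_norm_le_half ?_ ?_ hw
  · refine continuousOn_pi.2 fun i => continuousOn_pi.2 fun j => ?_
    by_cases hij : i = j
    · simp only [defect, hij, if_true]; exact continuousOn_const
    · simp only [defect, hij, if_false]
      exact ((hγ j).continuousOn_fderiv.clm_apply continuousOn_const).sub
        (h.rhs hγ hij).continuousOn
  · intro s hs S hS w hw
    have hsub : closedBall c s ⊆ ball c r := closedBall_subset_ball hs
    have hS0 : 0 ≤ S := (norm_nonneg _).trans (hS w hw)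
    have hs0 : 0 ≤ s := dist_nonneg.trans hw
    have hS' : ∀ x ∈ closedBall c s, ∀ i j, |defect a b γ x i j| ≤ S := fun x hx i j =>
      ((norm_le_pi_norm (defect a b γ x i) j).trans (norm_le_pi_norm (defect a b γ x) i)).trans
        (hS x hx)
    refine (pi_norm_le_iff_of_nonneg (by positivity)).2 fun k =>
      (pi_norm_le_iff_of_nonneg (by positivity)).2 fun j => ?_
    rw [Real.norm_eq_abs]
    by_cases hkj : k = j
    · simp only [defect, hkj, if_true, abs_zero]; positivity
    rw [key w (hsub hw) k j hkj]
    have hterm : ∀ i ∈ Finset.univ.erase j, |(w i - c i) * ∫ t in (0 : ℝ)..1,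
        t * (fderiv ℝ (DarbouxSystem.rhs a b γ i j) (ray c j w t) (Pi.single k 1) -
          fderiv ℝ (DarbouxSystem.rhs a b γ k j) (ray c j w t) (Pi.single i 1))| ≤
        r * (4 * M * S) := by
      intro i hi
      have hij := Finset.ne_of_mem_erase hi
      rw [abs_mul]
      refine mul_le_mul ((C1Bound.coord_sub i).abs_le w (hsub hw)) ?_ (abs_nonneg _) h.pos.le
      refine abs_integral_le_of_abs_le fun t ht => ?_
      have hx := ray_mem_closedBall j hw ht
      rw [abs_mul, abs_of_nonneg ht.1]
      refine (mul_le_of_le_one_left (abs_nonneg _) ht.2).trans ?_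
      by_cases hik : i = k
      · subst hik; simp; positivity
      rw [h.fderiv_rhs_sub hγ hij hkj hik (hsub hx) (hc _ (hsub hx))]
      have hb : ∀ (g : (Fin n → ℝ) → ℝ) (p q : Fin n), C1Bound g c r M M →
          |g (ray c j w t) * defect a b γ (ray c j w t) p q| ≤ M * S := fun g p q hg => by
        rw [abs_mul]
        exact mul_le_mul (hg.abs_le _ (hsub hx)) (hS' _ hx p q) (abs_nonneg _) hM
      have h1 := abs_le.1 (hb _ k j (h.left i j hij))
      have h2 := abs_le.1 (hb _ k i (h.right i j hij))
      have h3 := abs_le.1 (hb _ i j (h.left k j hkj))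
      have h4 := abs_le.1 (hb _ i k (h.right k j hkj))
      rw [abs_le]
      constructor <;> linarith [h1.1, h1.2, h2.1, h2.2, h3.1, h3.2, h4.1, h4.2]
    calc _ ≤ _ := Finset.abs_sum_le_sum_abs _ _
      _ ≤ _ := Finset.sum_le_sum hterm
      _ ≤ n * (r * (4 * M * S)) :=
        sum_erase_const_le j (mul_nonneg h.pos.le (by positivity))
      _ ≤ S / 2 := by nlinarith [mul_le_mul_of_nonneg_right h.small hS0]

/-- A solution that vanishes on the axes (its `j`-th component on the `j`-th axis) is zero. -/
lemma SmallCoeffs.eq_zero_of_defect_eq_zero (h : SmallCoeffs a b c r M)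
    (hγ : ∀ j, C1Bound (fun w => γ w j) c r A B)
    (hsol : ∀ w ∈ ball c r, defect a b γ w = 0)
    (h0 : ∀ j t, Function.update c j t ∈ ball c r → γ (Function.update c j t) j = 0)
    {w : Fin n → ℝ} (hw : w ∈ ball c r) : γ w = 0 := by
  have hM := h.nonneg
  refine eq_zero_of_norm_le_half (continuousOn_pi.2 fun j => (hγ j).continuousOn) ?_ hw
  intro s hs S hS w hw
  have hsub : closedBall c s ⊆ ball c r := closedBall_subset_ball hs
  have hS0 : 0 ≤ S := (norm_nonneg _).trans (hS w hw)
  have hS' : ∀ x ∈ closedBall c s, ∀ j, |γ x j| ≤ S := fun x hx j =>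
    (norm_le_pi_norm (γ x) j).trans (hS x hx)
  refine (pi_norm_le_iff_of_nonneg (by positivity)).2 fun j => ?_
  have hu : Function.update c j (w j) ∈ ball c r := by
    rw [← ray_zero]; exact ray_mem_ball j (hsub hw) ⟨le_rfl, zero_le_one⟩
  rw [Real.norm_eq_abs, (hγ j).eq_add_sum_rayMean j (hsub hw), h0 j _ hu, zero_add]
  have hterm : ∀ i ∈ Finset.univ.erase j, |(w i - c i) *
      rayMean c j (fun x => fderiv ℝ (fun w => γ w j) x (Pi.single i 1)) w| ≤
      r * (2 * M * S) := by
    intro i hi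
    have hij := Finset.ne_of_mem_erase hi
    rw [abs_mul]
    refine mul_le_mul ((C1Bound.coord_sub i).abs_le w (hsub hw)) ?_ (abs_nonneg _) h.pos.le
    refine abs_rayMean_le j (fun x hx => ?_) hw
    have hd := congrFun (congrFun (hsol x (hsub hx)) i) j
    rw [defect_of_ne hij, Pi.zero_apply, Pi.zero_apply, sub_eq_zero] at hd
    rw [hd, DarbouxSystem.rhs]
    calc _ ≤ |a i j x * γ x j| + |b i j x * γ x i| := abs_add_le _ _
      _ ≤ M * S + M * S := by
        rw [abs_mul, abs_mul]
        exact add_le_add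
          (mul_le_mul ((h.left i j hij).abs_le _ (hsub hx)) (hS' x hx j) (abs_nonneg _) hM)
          (mul_le_mul ((h.right i j hij).abs_le _ (hsub hx)) (hS' x hx i) (abs_nonneg _) hM)
      _ = _ := by ring
  calc _ ≤ _ := Finset.abs_sum_le_sum_abs _ _
    _ ≤ _ := Finset.sum_le_sum hterm
    _ ≤ n * (r * (2 * M * S)) :=
      sum_erase_const_le j (mul_nonneg h.pos.le (by positivity))
    _ ≤ S / 2 := by nlinarith [mul_le_mul_of_nonneg_right h.small hS0]

/-- `γ` is a `C¹` solution on `U` of the linear Darboux system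
`∂_i γ^j = a_{ij} γ^j + b_{ij} γ^i` for `i ≠ j`. -/
def IsSolutionOn (a b : Fin n → Fin n → (Fin n → ℝ) → ℝ) (U : Set (Fin n → ℝ))
    (γ : (Fin n → ℝ) → (Fin n → ℝ)) : Prop :=
  ContDiffOn ℝ 1 γ U ∧ ∀ w ∈ U, ∀ i j : Fin n, i ≠ j →
    fderiv ℝ γ w (Pi.single i 1) j = rhs a b γ i j w

lemma fderiv_comp_apply {w : Fin n → ℝ} (hγ : DifferentiableAt ℝ γ w) (j : Fin n)
    (v : Fin n → ℝ) : fderiv ℝ (fun x => γ x j) w v = fderiv ℝ γ w v j := by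
  rw [((hasFDerivAt_pi'.1 hγ.hasFDerivAt) j).fderiv]
  simp

lemma SmallCoeffs.mono_ball (h : SmallCoeffs a b c r M) {s : ℝ} (hs0 : 0 < s) (hs : s ≤ r) :
    SmallCoeffs a b c s M where
  left i j hij := (h.left i j hij).mono_ball hs
  right i j hij := (h.right i j hij).mono_ball hs
  pos := hs0
  nonneg := h.nonneg
  small := by
    have := h.nonneg
    exact (mul_le_mul_of_nonneg_left hs (by positivity)).trans h.small

lemma SmallCoeffs.eqOn_of_isSolutionOn (h : SmallCoeffs a b c r M)
    {γ δ : (Fin n → ℝ) → (Fin n → ℝ)} (hγ : IsSolutionOn a b (ball c r) γ)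
    (hδ : IsSolutionOn a b (ball c r) δ)
    (h0 : ∀ j t, Function.update c j t ∈ ball c r →
      γ (Function.update c j t) j = δ (Function.update c j t) j) :
    EqOn γ δ (ball c r) := by
  intro w hw
  -- The derivatives of `γ` and `δ` need not be bounded on `B(c, r)`, so pass to a smaller ball.
  obtain ⟨s, hs1, hs⟩ := exists_between (mem_ball.1 hw)
  have hsub : ball c s ⊆ ball c r := ball_subset_ball hs.le
  have hs0 : 0 < s := dist_nonneg.trans_lt hs1
  have hd : ContDiffOn ℝ 1 (fun w => γ w - δ w) (ball c r) := hγ.1.sub hδ.1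
  choose A B hAB using fun j => C1Bound.exists_of_contDiffOn
    ((contDiffOn_pi.1 hd) j) hs
  have hbd : ∀ j, C1Bound (fun w => (γ w - δ w) j) c s (∑ i, |A i|) (∑ i, |B i|) := fun j =>
    (hAB j).mono
      ((le_abs_self _).trans (Finset.single_le_sum (f := fun i => |A i|)
        (fun i _ => abs_nonneg _) (Finset.mem_univ j)))
      ((le_abs_self _).trans (Finset.single_le_sum (f := fun i => |B i|)
        (fun i _ => abs_nonneg _) (Finset.mem_univ j)))
  refine sub_eq_zero.1 ((h.mono_ball hs0 hs.le).eq_zero_of_defect_eq_zero hbd ?_ ?_ hs1)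
  · intro x hx
    have hγx := (hγ.1.differentiableOn one_ne_zero).differentiableAt
      (isOpen_ball.mem_nhds (hsub hx))
    have hδx := (hδ.1.differentiableOn one_ne_zero).differentiableAt
      (isOpen_ball.mem_nhds (hsub hx))
    ext i j
    by_cases hij : i = j
    · simp [defect, hij]
    rw [defect_of_ne hij, fderiv_comp_apply (γ := fun w => γ w - δ w) (hγx.sub hδx),
      fderiv_fun_sub hγx hδx, sub_apply, Pi.sub_apply,
      hγ.2 x (hsub hx) i j hij, hδ.2 x (hsub hx) i j hij]
    simp only [DarbouxSystem.rhs, Pi.sub_apply, Pi.zero_apply]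
    ring
  · intro j t ht
    rw [Pi.sub_apply, h0 j t (hsub ht), sub_self]

/-- **Local solvability of linear Darboux systems.** A compatible linear Darboux system with `C¹`
coefficients has, on every sufficiently small ball around `c`, exactly one `C¹` solution whose
`j`-th component is prescribed on the `j`-th axis through `c`. -/
theorem eventually_exists_unique_solution
    (ha : ∀ i j, i ≠ j → ContDiffAt ℝ 1 (a i j) c) (hb : ∀ i j, i ≠ j → ContDiffAt ℝ 1 (b i j) c)
    (hc : ∀ᶠ w in 𝓝 c, CompatibleAt a b w) {φ : Fin n → ℝ → ℝ}
    (hφ : ∀ j, ContDiffAt ℝ 1 (φ j) (c j)) :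
    ∀ᶠ r in 𝓝[>] (0 : ℝ),
      (∃ γ, IsSolutionOn a b (ball c r) γ ∧ BetaSystem.HasDataOn c φ (ball c r) γ) ∧
      ∀ γ δ, IsSolutionOn a b (ball c r) γ → IsSolutionOn a b (ball c r) δ →
        BetaSystem.HasDataOn c φ (ball c r) γ → BetaSystem.HasDataOn c φ (ball c r) δ →
        EqOn γ δ (ball c r) := by
  have hproj : ∀ j w, HasFDerivAt (fun w : Fin n → ℝ => w j)
      (ContinuousLinearMap.proj (R := ℝ) (φ := fun _ : Fin n => ℝ) j) w := fun j w =>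
    (ContinuousLinearMap.proj (R := ℝ) (φ := fun _ : Fin n => ℝ) j).hasFDerivAt
  have hφ' : ∀ j, ContDiffAt ℝ 1 (fun w : Fin n → ℝ => φ j (w j)) c := fun j =>
    (hφ j).comp c (contDiffAt_apply ..)
  have haE : ∀ i j, ∃ A, ∀ᶠ r in 𝓝[>] (0 : ℝ), i ≠ j → C1Bound (a i j) c r A A := fun i j => by
    by_cases hij : i = j
    · exact ⟨0, by simp [hij]⟩
    · obtain ⟨A, hA⟩ := C1Bound.eventually_of_contDiffAt (ha i j hij)
      exact ⟨A, hA.mono fun r h _ => h⟩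
  have hbE : ∀ i j, ∃ A, ∀ᶠ r in 𝓝[>] (0 : ℝ), i ≠ j → C1Bound (b i j) c r A A := fun i j => by
    by_cases hij : i = j
    · exact ⟨0, by simp [hij]⟩
    · obtain ⟨A, hA⟩ := C1Bound.eventually_of_contDiffAt (hb i j hij)
      exact ⟨A, hA.mono fun r h _ => h⟩
  choose Ma hMa using haE
  choose Mb hMb using hbE
  choose Mf hMf using fun j => C1Bound.eventually_of_contDiffAt (hφ' j)
  let M : ℝ := ∑ p : Fin n × Fin n, (|Ma p.1 p.2| + |Mb p.1 p.2|)
  let K : ℝ := ∑ j, |Mf j|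
  have hM0 : 0 ≤ M := Finset.sum_nonneg fun _ _ => by positivity
  have hK0 : 0 ≤ K := Finset.sum_nonneg fun _ _ => by positivity
  have hMle : ∀ i j, |Ma i j| + |Mb i j| ≤ M := fun i j =>
    Finset.single_le_sum (f := fun p : Fin n × Fin n => |Ma p.1 p.2| + |Mb p.1 p.2|)
      (fun _ _ => by positivity) (Finset.mem_univ (i, j))
  have hMale : ∀ i j, Ma i j ≤ M := fun i j =>
    ((le_abs_self _).trans (le_add_of_nonneg_right (abs_nonneg _))).trans (hMle i j)
  have hMble : ∀ i j, Mb i j ≤ M := fun i j =>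
    ((le_abs_self _).trans (le_add_of_nonneg_left (abs_nonneg _))).trans (hMle i j)
  have hMfle : ∀ j, Mf j ≤ K := fun j => (le_abs_self _).trans
    (Finset.single_le_sum (f := fun j => |Mf j|) (fun _ _ => abs_nonneg _) (Finset.mem_univ j))
  have hsmall : ∀ᶠ r in 𝓝[>] (0 : ℝ), 8 * n * M * r ≤ 1 := by
    have : Tendsto (fun r : ℝ => 8 * n * M * r) (𝓝[>] 0) (𝓝 (8 * n * M * 0)) :=
      (tendsto_id.const_mul _).mono_left nhdsWithin_le_nhds
    rw [mul_zero] at this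
    exact this.eventually (ge_mem_nhds one_pos)
  have hdφ : ∀ᶠ w in 𝓝 c, ∀ j, DifferentiableAt ℝ (φ j) (w j) :=
    eventually_all.2 fun j => (continuous_apply j).continuousAt.eventually
      (((hφ j).eventually (by simp)).mono fun t ht => ht.differentiableAt one_ne_zero)
  obtain ⟨ε, hε, hcε⟩ := Metric.eventually_nhds_iff_ball.1 (hc.and hdφ)
  filter_upwards [eventually_all.2 fun i => eventually_all.2 fun j => hMa i j,
    eventually_all.2 fun i => eventually_all.2 fun j => hMb i j, eventually_all.2 hMf, hsmall,
    Ioo_mem_nhdsGT hε] with r h1 h2 h3 h4 h5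
  have hsub : ball c r ⊆ ball c ε := ball_subset_ball h5.2.le
  have h : SmallCoeffs a b c r M :=
    ⟨fun i j hij => (h1 i j hij).mono (hMale i j) (hMale i j),
      fun i j hij => (h2 i j hij).mono (hMble i j) (hMble i j), h5.1, hM0, h4⟩
  refine ⟨?_, fun γ δ hγ hδ hγ0 hδ0 => h.eqOn_of_isSolutionOn hγ hδ fun j t ht => by
    rw [hγ0 j t ht, hδ0 j t ht]⟩
  let f : (Fin n → ℝ) → (Fin n → ℝ) := fun w j => φ j (w j)
  have hf : ∀ j, C1Bound (fun w => f w j) c r K K := fun j => (h3 j).mono (hMfle j) (hMfle j)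
  obtain ⟨γ, A, B, hγ, hfix⟩ := h.exists_eq_add_picard hK0 hf
  have hγ1 : ContDiffOn ℝ 1 γ (ball c r) := contDiffOn_pi.2 fun j => (hγ j).contDiffOn
  refine ⟨γ, ⟨hγ1, fun w hw i j hij => ?_⟩, fun j t ht => ?_⟩
  · have hz := h.defect_eq_zero hγ (fun w hw => (hcε w (hsub hw)).1) hf ?_ hfix hw
    · have hz' := congrFun (congrFun hz i) j
      rw [defect_of_ne hij, fderiv_comp_apply ((hγ1.differentiableOn one_ne_zero).differentiableAt
        (isOpen_ball.mem_nhds hw))] at hz'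
      exact sub_eq_zero.1 hz'
    · intro x hx k j hkj
      have := ((hcε x (hsub hx)).2 j).hasDerivAt.comp_hasFDerivAt x (hproj j x)
      rw [show (fun x => f x j) = φ j ∘ fun w => w j from rfl, this.fderiv]
      simp [hkj.symm]
  · rw [hfix _ ht j]
    have : DarbouxSystem.picard a b c γ (Function.update c j t) j = 0 :=
      Finset.sum_eq_zero fun i hi => by simp [Finset.ne_of_mem_erase hi]
    rw [this, add_zero]
    simp [f]

end

end DarbouxSystem

namespace BetaSystem

noncomputable section

variable {n : ℕ} {R : Fin n → (Fin n → ℝ) → (Fin n → ℝ)}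
  {ρ : OpenPartialHomeomorph (Fin n → ℝ) (Fin n → ℝ)}

/-! ### Riemann coordinates -/

/-- The linear map that sends the standard basis to the frame at `u`. -/
def frameMap (R : Fin n → (Fin n → ℝ) → (Fin n → ℝ)) (u : Fin n → ℝ) :
    (Fin n → ℝ) →L[ℝ] (Fin n → ℝ) :=
  ∑ j, (ContinuousLinearMap.proj (R := ℝ) (φ := fun _ : Fin n => ℝ) j).smulRight (R j u)

lemma frameMap_apply (u v : Fin n → ℝ) : frameMap R u v = ∑ j, v j • R j u := by
  simp [frameMap]

lemma frameMap_single (u : Fin n → ℝ) (j : Fin n) : frameMap R u (Pi.single j 1) = R j u := by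
  rw [frameMap_apply, Finset.sum_eq_single j]
  · simp
  · intro i _ hij; simp [hij]
  · simp

lemma IsRiemannCoordinates.fderiv_frame (hρ : IsRiemannCoordinates R ρ) {u : Fin n → ℝ}
    (hu : u ∈ ρ.source) (j : Fin n) : fderiv ℝ ρ u (R j u) = Pi.single j 1 := by
  ext i
  rw [(hρ u hu).2 i j, Pi.single_apply]

lemma IsRiemannCoordinates.fderiv_frameMap (hρ : IsRiemannCoordinates R ρ) {u : Fin n → ℝ}
    (hu : u ∈ ρ.source) (v : Fin n → ℝ) : fderiv ℝ ρ u (frameMap R u v) = v := by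
  rw [frameMap_apply, map_sum]
  simp only [map_smul, hρ.fderiv_frame hu]
  ext i
  simp [Pi.single_apply]

lemma IsRiemannCoordinates.frameMap_fderiv (hρ : IsRiemannCoordinates R ρ) {u : Fin n → ℝ}
    (hu : u ∈ ρ.source) (v : Fin n → ℝ) : frameMap R u (fderiv ℝ ρ u v) = v := by
  have h : (fderiv ℝ ρ u : (Fin n → ℝ) →ₗ[ℝ] (Fin n → ℝ)) *
      (frameMap R u : (Fin n → ℝ) →ₗ[ℝ] (Fin n → ℝ)) = 1 :=
    LinearMap.ext fun x => hρ.fderiv_frameMap hu x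
  exact LinearMap.congr_fun (mul_eq_one_comm.1 h) v

/-- Expansion of a vector in the frame: the coframe is `dw^1, …, dw^n`. -/
lemma IsRiemannCoordinates.eq_sum_frame (hρ : IsRiemannCoordinates R ρ) {u : Fin n → ℝ}
    (hu : u ∈ ρ.source) (v : Fin n → ℝ) : v = ∑ k, fderiv ℝ ρ u v k • R k u := by
  rw [← frameMap_apply, hρ.frameMap_fderiv hu]

lemma IsRiemannCoordinates.coframeMatrix_eq (hρ : IsRiemannCoordinates R ρ) {u : Fin n → ℝ}
    (hu : u ∈ ρ.source) :
    coframeMatrix R u = Matrix.of fun k m => fderiv ℝ ρ u (Pi.single m 1) k := by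
  refine Matrix.inv_eq_left_inv ?_
  ext k j
  have h : R j u = ∑ m, R j u m • (Pi.single m 1 : Fin n → ℝ) := by
    ext i; simp [Pi.single_apply]
  have h2 := congrArg (fun v => fderiv ℝ ρ u v k) h
  simp only [map_sum, map_smul, hρ.fderiv_frame hu, Finset.sum_apply, Pi.smul_apply,
    smul_eq_mul] at h2
  rw [Matrix.mul_apply, Matrix.one_apply]
  simp only [frameMatrix, Matrix.of_apply]
  rw [Pi.single_apply] at h2
  rw [h2]
  exact Finset.sum_congr rfl fun m _ => mul_comm _ _

lemma IsRiemannCoordinates.christoffel_eq (hρ : IsRiemannCoordinates R ρ) {u : Fin n → ℝ}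
    (hu : u ∈ ρ.source) (i j k : Fin n) :
    christoffel R i j k u = fderiv ℝ ρ u (fderiv ℝ (R j) u (R i u)) k := by
  set v := fderiv ℝ (R j) u (R i u) with hv
  have h : v = ∑ m, v m • (Pi.single m 1 : Fin n → ℝ) := by
    ext i; simp [Pi.single_apply]
  rw [christoffel, hρ.coframeMatrix_eq hu, ← hv]
  conv_rhs => rw [h]
  simp only [map_sum, map_smul, Finset.sum_apply, Pi.smul_apply, smul_eq_mul, Matrix.of_apply]
  exact Finset.sum_congr rfl fun m _ => mul_comm _ _

lemma IsRiemannCoordinates.hasFDerivAt_equiv (hρ : IsRiemannCoordinates R ρ) {u : Fin n → ℝ}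
    (hu : u ∈ ρ.source) : ∃ e : (Fin n → ℝ) ≃L[ℝ] (Fin n → ℝ),
      HasFDerivAt ρ (e : (Fin n → ℝ) →L[ℝ] (Fin n → ℝ)) u ∧
      (e.symm : (Fin n → ℝ) →L[ℝ] (Fin n → ℝ)) = frameMap R u :=
  ⟨ContinuousLinearEquiv.equivOfInverse (fderiv ℝ ρ u) (frameMap R u)
    (hρ.frameMap_fderiv hu) (hρ.fderiv_frameMap hu), (hρ u hu).1.hasFDerivAt, rfl⟩

lemma IsRiemannCoordinates.hasFDerivAt_symm (hρ : IsRiemannCoordinates R ρ) {w : Fin n → ℝ}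
    (hw : w ∈ ρ.target) : HasFDerivAt ρ.symm (frameMap R (ρ.symm w)) w := by
  obtain ⟨e, he, hes⟩ := hρ.hasFDerivAt_equiv (ρ.map_target hw)
  rw [← hes]
  exact ρ.hasFDerivAt_symm hw he

lemma IsRiemannCoordinates.fderiv_symm_single (hρ : IsRiemannCoordinates R ρ) {w : Fin n → ℝ}
    (hw : w ∈ ρ.target) (j : Fin n) :
    fderiv ℝ ρ.symm w (Pi.single j 1) = R j (ρ.symm w) := by
  rw [(hρ.hasFDerivAt_symm hw).fderiv, frameMap_single]

lemma IsFrameOn.contDiffOn_frameMap {Ω : Set (Fin n → ℝ)} (hframe : IsFrameOn R Ω) :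
    ContDiffOn ℝ 2 (frameMap R) Ω := by
  unfold frameMap
  refine ContDiffOn.sum fun j _ => ?_
  exact contDiffOn_const.smulRight (hframe.1 j)

/-- The inverse of a Riemann coordinate map gains derivatives, as its differential is the frame. -/
lemma IsRiemannCoordinates.contDiffOn_symm (hρ : IsRiemannCoordinates R ρ)
    (hframe : IsFrameOn R ρ.source) : ContDiffOn ℝ 3 ρ.symm ρ.target := by
  have step : ∀ k : ℕ, (k : WithTop ℕ∞) ≤ 2 → ContDiffOn ℝ k ρ.symm ρ.target →
      ContDiffOn ℝ (k + 1) ρ.symm ρ.target := by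
    intro k hk h
    rw [contDiffOn_succ_iff_fderiv_of_isOpen ρ.open_target]
    refine ⟨fun w hw => (hρ.hasFDerivAt_symm hw).differentiableAt.differentiableWithinAt,
      by simp, ?_⟩
    exact ((hframe.contDiffOn_frameMap.of_le hk).comp h fun w hw => ρ.map_target hw).congr
      fun w hw => (hρ.hasFDerivAt_symm hw).fderiv
  have h0 : ContDiffOn ℝ (0 : ℕ) ρ.symm ρ.target := contDiffOn_zero.2 ρ.continuousOn_symm
  have h1 := step 0 (by norm_num) h0
  have h2 := step 1 (by norm_num) (by exact_mod_cast h1)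
  have h3 := step 2 (by norm_num) (by exact_mod_cast h2)
  exact_mod_cast h3

lemma IsRiemannCoordinates.contDiffOn (hρ : IsRiemannCoordinates R ρ)
    (hframe : IsFrameOn R ρ.source) : ContDiffOn ℝ 3 ρ ρ.source := by
  intro u hu
  obtain ⟨e, he, -⟩ := hρ.hasFDerivAt_equiv hu
  have h1 : HasFDerivAt ρ.symm (e.symm : (Fin n → ℝ) →L[ℝ] (Fin n → ℝ)) (ρ.symm.symm u) := by
    rw [ρ.symm_symm]
    refine ρ.hasFDerivAt_symm (ρ.map_source hu) ?_
    rwa [ρ.left_inv hu]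
  have h2 : ContDiffAt ℝ 3 ρ.symm (ρ.symm.symm u) := by
    rw [ρ.symm_symm]
    exact (hρ.contDiffOn_symm hframe).contDiffAt (ρ.open_target.mem_nhds (ρ.map_source hu))
  have h3 := ρ.symm.contDiffAt_symm (by simpa using hu) h1 h2
  rw [ρ.symm_symm] at h3
  exact h3.contDiffWithinAt

/-! ### The connection in Riemann coordinates -/

/-- The frame field `R_j` as a function of the Riemann coordinates. -/
def coordField (R : Fin n → (Fin n → ℝ) → (Fin n → ℝ))
    (ρ : OpenPartialHomeomorph (Fin n → ℝ) (Fin n → ℝ)) (j : Fin n) (w : Fin n → ℝ) : Fin n → ℝ :=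
  R j (ρ.symm w)

lemma contDiffOn_coordField (hframe : IsFrameOn R ρ.source) (hρ : IsRiemannCoordinates R ρ)
    (j : Fin n) : ContDiffOn ℝ 2 (coordField R ρ j) ρ.target :=
  (hframe.1 j).comp ((hρ.contDiffOn_symm hframe).of_le (by norm_num))
    fun _ hw => ρ.map_target hw

lemma differentiableAt_coordField (hframe : IsFrameOn R ρ.source)
    (hρ : IsRiemannCoordinates R ρ) (j : Fin n) {w : Fin n → ℝ} (hw : w ∈ ρ.target) :
    DifferentiableAt ℝ (coordField R ρ j) w :=
  ((contDiffOn_coordField hframe hρ j).differentiableOn two_ne_zero).differentiableAt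
    (ρ.open_target.mem_nhds hw)

lemma fderiv_coordField (hframe : IsFrameOn R ρ.source) (hρ : IsRiemannCoordinates R ρ)
    (i j : Fin n) {w : Fin n → ℝ} (hw : w ∈ ρ.target) :
    fderiv ℝ (coordField R ρ j) w (Pi.single i 1) =
      fderiv ℝ (R j) (ρ.symm w) (R i (ρ.symm w)) := by
  have hd : DifferentiableAt ℝ (R j) (ρ.symm w) :=
    ((hframe.1 j).differentiableOn two_ne_zero).differentiableAt
      (ρ.open_source.mem_nhds (ρ.map_target hw))
  have := hd.hasFDerivAt.comp w (hρ.hasFDerivAt_symm hw)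
  rw [show coordField R ρ j = R j ∘ ρ.symm from rfl, this.fderiv,
    ContinuousLinearMap.comp_apply, frameMap_single]

lemma riemannChristoffel_eq (hframe : IsFrameOn R ρ.source) (hρ : IsRiemannCoordinates R ρ)
    (i j k : Fin n) {w : Fin n → ℝ} (hw : w ∈ ρ.target) :
    riemannChristoffel R ρ i j k w =
      fderiv ℝ ρ (ρ.symm w) (fderiv ℝ (coordField R ρ j) w (Pi.single i 1)) k := by
  rw [riemannChristoffel, hρ.christoffel_eq (ρ.map_target hw), fderiv_coordField hframe hρ i j hw]

/-- `∂_i R_j = Σ_k Z_{ij}^k R_k`. -/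
lemma fderiv_coordField_eq_sum (hframe : IsFrameOn R ρ.source) (hρ : IsRiemannCoordinates R ρ)
    (i j : Fin n) {w : Fin n → ℝ} (hw : w ∈ ρ.target) :
    fderiv ℝ (coordField R ρ j) w (Pi.single i 1) =
      ∑ k, riemannChristoffel R ρ i j k w • coordField R ρ k w := by
  conv_lhs => rw [hρ.eq_sum_frame (ρ.map_target hw)
    (fderiv ℝ (coordField R ρ j) w (Pi.single i 1))]
  exact Finset.sum_congr rfl fun k _ => by rw [riemannChristoffel_eq hframe hρ i j k hw]; rfl

lemma contDiffOn_riemannChristoffel (hframe : IsFrameOn R ρ.source)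
    (hρ : IsRiemannCoordinates R ρ) (i j k : Fin n) :
    ContDiffOn ℝ 1 (riemannChristoffel R ρ i j k) ρ.target := by
  have h1 : ContDiffOn ℝ 1 (fun w => fderiv ℝ ρ (ρ.symm w)) ρ.target :=
    (((hρ.contDiffOn hframe).fderiv_of_isOpen ρ.open_source (m := 1) (by norm_num))).comp
      ((hρ.contDiffOn_symm hframe).of_le (by norm_num)) fun _ hw => ρ.map_target hw
  have h2 : ContDiffOn ℝ 1 (fun w => fderiv ℝ (coordField R ρ j) w (Pi.single i 1)) ρ.target :=
    ((contDiffOn_coordField hframe hρ j).fderiv_of_isOpen ρ.open_target (m := 1)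
      (by norm_num)).clm_apply contDiffOn_const
  exact (contDiffOn_pi.1 (h1.clm_apply h2) k).congr
    fun w hw => riemannChristoffel_eq hframe hρ i j k hw

/-- The connection has no torsion, as the `R_j` are the partial derivatives of `ρ⁻¹`. -/
lemma riemannChristoffel_symm (hframe : IsFrameOn R ρ.source) (hρ : IsRiemannCoordinates R ρ)
    (i j k : Fin n) {w : Fin n → ℝ} (hw : w ∈ ρ.target) :
    riemannChristoffel R ρ i j k w = riemannChristoffel R ρ j i k w := by
  have hC : ContDiffAt ℝ 3 ρ.symm w :=
    (hρ.contDiffOn_symm hframe).contDiffAt (ρ.open_target.mem_nhds hw)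
  have hd : DifferentiableAt ℝ (fderiv ℝ ρ.symm) w :=
    (hC.fderiv_right (m := 2) (by norm_num)).differentiableAt two_ne_zero
  have key : ∀ p q : Fin n, fderiv ℝ (coordField R ρ q) w (Pi.single p 1) =
      fderiv ℝ (fderiv ℝ ρ.symm) w (Pi.single p 1) (Pi.single q 1) := by
    intro p q
    have he : coordField R ρ q =ᶠ[𝓝 w] fun x => fderiv ℝ ρ.symm x (Pi.single q 1) := by
      filter_upwards [ρ.open_target.mem_nhds hw] with x hx
      rw [hρ.fderiv_symm_single hx]; rfl
    rw [he.fderiv_eq, fderiv_clm_apply hd (differentiableAt_const _)]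
    simp
  rw [riemannChristoffel_eq hframe hρ i j k hw, riemannChristoffel_eq hframe hρ j i k hw, key, key,
    (hC.isSymmSndFDerivAt (by simp; norm_num)).eq]

/-- The connection is flat: `∂_l ∂_i R_j = ∂_i ∂_l R_j`, written in the frame. -/
lemma riemannChristoffel_flat (hframe : IsFrameOn R ρ.source) (hρ : IsRiemannCoordinates R ρ)
    (l i j k : Fin n) {w : Fin n → ℝ} (hw : w ∈ ρ.target) :
    fderiv ℝ (riemannChristoffel R ρ i j k) w (Pi.single l 1) +
        ∑ m, riemannChristoffel R ρ i j m w * riemannChristoffel R ρ l m k w =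
      fderiv ℝ (riemannChristoffel R ρ l j k) w (Pi.single i 1) +
        ∑ m, riemannChristoffel R ρ l j m w * riemannChristoffel R ρ i m k w := by
  have hC : ContDiffAt ℝ 2 (coordField R ρ j) w :=
    (contDiffOn_coordField hframe hρ j).contDiffAt (ρ.open_target.mem_nhds hw)
  have hd : DifferentiableAt ℝ (fderiv ℝ (coordField R ρ j)) w :=
    (hC.fderiv_right (m := 1) (by norm_num)).differentiableAt one_ne_zero
  have key : ∀ p q : Fin n, fderiv ℝ ρ (ρ.symm w)
      (fderiv ℝ (fderiv ℝ (coordField R ρ j)) w (Pi.single p 1) (Pi.single q 1)) k =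
      fderiv ℝ (riemannChristoffel R ρ q j k) w (Pi.single p 1) +
        ∑ m, riemannChristoffel R ρ q j m w * riemannChristoffel R ρ p m k w := by
    intro p q
    have h1 : fderiv ℝ (fun x => fderiv ℝ (coordField R ρ j) x (Pi.single q 1)) w (Pi.single p 1) =
        fderiv ℝ (fderiv ℝ (coordField R ρ j)) w (Pi.single p 1) (Pi.single q 1) := by
      rw [fderiv_clm_apply hd (differentiableAt_const _)]
      simp
    have he : (fun x => fderiv ℝ (coordField R ρ j) x (Pi.single q 1)) =ᶠ[𝓝 w]
        fun x => ∑ m, riemannChristoffel R ρ q j m x • coordField R ρ m x := by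
      filter_upwards [ρ.open_target.mem_nhds hw] with x hx
      exact fderiv_coordField_eq_sum hframe hρ q j hx
    have hsum : HasFDerivAt (fun x => ∑ m, riemannChristoffel R ρ q j m x • coordField R ρ m x)
        (∑ m, (riemannChristoffel R ρ q j m w • fderiv ℝ (coordField R ρ m) w +
          (fderiv ℝ (riemannChristoffel R ρ q j m) w).smulRight (coordField R ρ m w))) w :=
      HasFDerivAt.fun_sum fun m _ =>
        (((contDiffOn_riemannChristoffel hframe hρ q j m).differentiableOn
          one_ne_zero).differentiableAt (ρ.open_target.mem_nhds hw)).hasFDerivAt.smul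
          (differentiableAt_coordField hframe hρ m hw).hasFDerivAt
    have hX : ∀ m, fderiv ℝ ρ (ρ.symm w) (coordField R ρ m w) = Pi.single m 1 := fun m =>
      hρ.fderiv_frame (ρ.map_target hw) m
    rw [← h1, he.fderiv_eq, hsum.fderiv, sum_apply, map_sum, Finset.sum_apply]
    simp only [add_apply, smul_apply, ContinuousLinearMap.smulRight_apply, map_add, map_smul, hX,
      Pi.add_apply, Pi.smul_apply, smul_eq_mul, ← riemannChristoffel_eq hframe hρ p _ k hw]
    rw [Finset.sum_add_distrib, add_comm]
    congr 1
    simp [Pi.single_apply]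
  rw [← key l i, ← key i l, (hC.isSymmSndFDerivAt (by simp)).eq]

/-- The coefficients `a_{ij} = Z_{ji}^j` of the `β`-system as a linear Darboux system. -/
def betaLeft (R : Fin n → (Fin n → ℝ) → (Fin n → ℝ))
    (ρ : OpenPartialHomeomorph (Fin n → ℝ) (Fin n → ℝ)) (i j : Fin n) : (Fin n → ℝ) → ℝ :=
  riemannChristoffel R ρ j i j

/-- The coefficients `b_{ij} = -Z_{jj}^i` of the `β`-system as a linear Darboux system. -/
def betaRight (R : Fin n → (Fin n → ℝ) → (Fin n → ℝ))
    (ρ : OpenPartialHomeomorph (Fin n → ℝ) (Fin n → ℝ)) (i j : Fin n) (w : Fin n → ℝ) : ℝ :=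
  -riemannChristoffel R ρ j j i w

lemma isBetaSolutionOn_iff {U : Set (Fin n → ℝ)} {γ : (Fin n → ℝ) → (Fin n → ℝ)} :
    IsBetaSolutionOn R ρ U γ ↔
      DarbouxSystem.IsSolutionOn (betaLeft R ρ) (betaRight R ρ) U γ := by
  simp only [IsBetaSolutionOn, DarbouxSystem.IsSolutionOn, DarbouxSystem.rhs, betaLeft, betaRight,
    neg_mul, sub_eq_add_neg]

/-- When `Z_{ij}^k = 0` for distinct `i, j, k`, flatness of the connection is the compatibility of
the `β`-system. -/
lemma compatibleAt_beta (hframe : IsFrameOn R ρ.source) (hρ : IsRiemannCoordinates R ρ)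
    (hZ : ∀ i j k : Fin n, i ≠ j → j ≠ k → i ≠ k →
      ∀ w ∈ ρ.target, riemannChristoffel R ρ i j k w = 0) {w : Fin n → ℝ} (hw : w ∈ ρ.target) :
    DarbouxSystem.CompatibleAt (betaLeft R ρ) (betaRight R ρ) w := by
  intro i j k hij hjk hik
  have hsymm : ∀ p q m, riemannChristoffel R ρ p q m =ᶠ[𝓝 w] riemannChristoffel R ρ q p m :=
    fun p q m => by
      filter_upwards [ρ.open_target.mem_nhds hw] with x hx
      exact riemannChristoffel_symm hframe hρ p q m hx
  constructor
  · have h := riemannChristoffel_flat hframe hρ k i j j hw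
    rw [Finset.sum_eq_single j, Finset.sum_eq_single j] at h
    · rw [betaLeft, betaLeft, (hsymm j i j).fderiv_eq, (hsymm j k j).fderiv_eq]
      linarith
    · intro m _ hm
      by_cases hmk : m = k
      · rw [hmk, hZ i k j hik hjk.symm hij w hw, mul_zero]
      · rw [hZ k j m hjk.symm hm.symm (Ne.symm hmk) w hw, zero_mul]
    · simp
    · intro m _ hm
      by_cases hmi : m = i
      · rw [hmi, hZ k i j hik.symm hij hjk.symm w hw, mul_zero]
      · rw [hZ i j m hij hm.symm (Ne.symm hmi) w hw, zero_mul]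
    · simp
  · have h := riemannChristoffel_flat hframe hρ i j j k hw
    have h0 : riemannChristoffel R ρ i j k =ᶠ[𝓝 w] fun _ => 0 := by
      filter_upwards [ρ.open_target.mem_nhds hw] with x hx
      exact hZ i j k hij hjk hik x hx
    rw [h0.fderiv_eq, Finset.sum_eq_add i k hik, Finset.sum_eq_single j] at h
    · have hn : fderiv ℝ (betaRight R ρ k j) w = -fderiv ℝ (riemannChristoffel R ρ j j k) w :=
        fderiv_fun_neg
      rw [hn]
      simp only [betaLeft, betaRight, neg_apply]
      rw [riemannChristoffel_symm hframe hρ j i j hw, riemannChristoffel_symm hframe hρ k i k hw]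
      simp only [fderiv_fun_const, Pi.zero_apply, zero_apply] at h
      linarith
    · intro m _ hm
      by_cases hmi : m = i
      · rw [hmi, hZ j i k hij.symm hik hjk w hw, mul_zero]
      · rw [hZ i j m hij hm.symm (Ne.symm hmi) w hw, zero_mul]
    · simp
    · intro m _ hm
      by_cases hmj : m = j
      · rw [hmj, hZ i j k hij hjk hik w hw, mul_zero]
      · rw [hZ i m k hm.1.symm hm.2 hik w hw, mul_zero]
    · simp
    · simp

/-! ### Hessians that are diagonal in the frame -/

-- Needed for the normed space structure on continuous bilinear forms.
set_option maxSynthPendingDepth 3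

/-- `H` is diagonal in the frame at the point with Riemann coordinates `w`, with diagonal entries
`g`. -/
def IsDiagonalAt (R : Fin n → (Fin n → ℝ) → (Fin n → ℝ))
    (ρ : OpenPartialHomeomorph (Fin n → ℝ) (Fin n → ℝ))
    (H : (Fin n → ℝ) → (Fin n → ℝ) →L[ℝ] (Fin n → ℝ) →L[ℝ] ℝ) (w g : Fin n → ℝ) : Prop :=
  ∀ j k, H (ρ.symm w) (coordField R ρ j w) (coordField R ρ k w) = if j = k then g j else 0

variable {H : (Fin n → ℝ) → (Fin n → ℝ) →L[ℝ] (Fin n → ℝ) →L[ℝ] ℝ}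
  {γ : (Fin n → ℝ) → (Fin n → ℝ)} {w : Fin n → ℝ}

/-- Continuous linear maps that agree on the frame are equal. -/
lemma IsRiemannCoordinates.clm_ext (hρ : IsRiemannCoordinates R ρ) (hw : w ∈ ρ.target)
    {F : Type*} [NormedAddCommGroup F] [NormedSpace ℝ F] {f g : (Fin n → ℝ) →L[ℝ] F}
    (h : ∀ j, f (coordField R ρ j w) = g (coordField R ρ j w)) : f = g := by
  ext1 x
  rw [hρ.eq_sum_frame (ρ.map_target hw) x]
  simp only [map_sum, map_smul]
  exact Finset.sum_congr rfl fun j _ => congrArg _ (h j)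

/-- The derivative of a field of bilinear forms that is diagonal in the frame. -/
lemma fderiv_diagonal (hframe : IsFrameOn R ρ.source) (hρ : IsRiemannCoordinates R ρ)
    (hw : w ∈ ρ.target) (hH : DifferentiableAt ℝ H (ρ.symm w))
    (hdiag : ∀ᶠ x in 𝓝 w, IsDiagonalAt R ρ H x (γ x)) (i j k : Fin n) :
    fderiv ℝ H (ρ.symm w) (coordField R ρ i w) (coordField R ρ j w) (coordField R ρ k w) =
      (if j = k then fderiv ℝ (fun x => γ x j) w (Pi.single i 1) else 0) -
        riemannChristoffel R ρ i j k w * γ w k - riemannChristoffel R ρ i k j w * γ w j := by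
  have h1 : HasFDerivAt (fun x => H (ρ.symm x)) ((fderiv ℝ H (ρ.symm w)).comp
      (frameMap R (ρ.symm w))) w := hH.hasFDerivAt.comp w (hρ.hasFDerivAt_symm hw)
  have hj := (differentiableAt_coordField hframe hρ j hw).hasFDerivAt
  have hk := (differentiableAt_coordField hframe hρ k hw).hasFDerivAt
  have h2 := ((h1.clm_apply hj).clm_apply hk).fderiv
  have h3 := DFunLike.congr_fun h2 (Pi.single i 1)
  have he : (fun x => H (ρ.symm x) (coordField R ρ j x) (coordField R ρ k x)) =ᶠ[𝓝 w]
      fun x => if j = k then γ x j else 0 := hdiag.mono fun x hx => hx j k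
  have hd := hdiag.self_of_nhds
  have hg : fderiv ℝ (fun x => if j = k then γ x j else 0) w (Pi.single i 1) =
      if j = k then fderiv ℝ (fun x => γ x j) w (Pi.single i 1) else 0 := by
    split_ifs <;> simp
  rw [he.fderiv_eq, hg] at h3
  rw [h3]
  simp only [add_apply, ContinuousLinearMap.comp_apply, ContinuousLinearMap.flip_apply,
    frameMap_single, fderiv_coordField_eq_sum hframe hρ i _ hw, map_sum, map_smul, sum_apply,
    smul_apply, smul_eq_mul, hd _ _, mul_ite, mul_zero, Finset.sum_ite_eq, Finset.sum_ite_eq',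
    Finset.mem_univ, if_true]
  change _ = _ + _ - _ - _
  rw [show R i (ρ.symm w) = coordField R ρ i w from rfl]
  ring

/-- If `H` has diagonal entries `γ` in the frame, then the first derivative of `H` is symmetric in its
first two arguments exactly when `γ` satisfies the `β`-system. -/
lemma fderiv_diagonal_symm_iff (hframe : IsFrameOn R ρ.source) (hρ : IsRiemannCoordinates R ρ)
    (hZ : ∀ i j k : Fin n, i ≠ j → j ≠ k → i ≠ k →
      ∀ w ∈ ρ.target, riemannChristoffel R ρ i j k w = 0)
    (hw : w ∈ ρ.target) (hH : DifferentiableAt ℝ H (ρ.symm w))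
    (hdiag : ∀ᶠ x in 𝓝 w, IsDiagonalAt R ρ H x (γ x)) :
    (∀ x y, fderiv ℝ H (ρ.symm w) x y = fderiv ℝ H (ρ.symm w) y x) ↔
      ∀ i j, i ≠ j → fderiv ℝ (fun x => γ x j) w (Pi.single i 1) =
        riemannChristoffel R ρ j i j w * γ w j - riemannChristoffel R ρ j j i w * γ w i := by
  have hD := fderiv_diagonal hframe hρ hw hH hdiag
  constructor
  · intro h i j hij
    have h1 := hD i j j
    rw [h, hD, if_pos rfl, if_neg hij, riemannChristoffel_symm hframe hρ i j j hw] at h1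
    linarith
  · intro h
    have key : ∀ i j k, fderiv ℝ H (ρ.symm w) (coordField R ρ i w) (coordField R ρ j w)
        (coordField R ρ k w) = fderiv ℝ H (ρ.symm w) (coordField R ρ j w) (coordField R ρ i w)
        (coordField R ρ k w) := by
      intro i j k
      by_cases hij : i = j
      · rw [hij]
      rw [hD, hD, riemannChristoffel_symm hframe hρ i j k hw]
      by_cases hjk : j = k
      · subst hjk
        rw [if_pos rfl, if_neg hij, h i j hij, riemannChristoffel_symm hframe hρ i j j hw]
        ring
      by_cases hik : i = k
      · subst hik
        rw [if_pos rfl, if_neg hjk, h j i hjk, riemannChristoffel_symm hframe hρ i j i hw]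
        ring
      rw [if_neg hjk, if_neg hik, hZ i k j hik (Ne.symm hjk) hij w hw,
        hZ j k i hjk (Ne.symm hik) (Ne.symm hij) w hw]
      ring
    have hflip : fderiv ℝ H (ρ.symm w) = (fderiv ℝ H (ρ.symm w)).flip :=
      hρ.clm_ext hw fun i => hρ.clm_ext hw fun j => hρ.clm_ext hw fun k => key i j k
    exact fun x y => congrArg (fun B => B x y) hflip

lemma isOpen_target_inter_preimage {V : Set (Fin n → ℝ)} (hV : IsOpen V) :
    IsOpen (ρ.target ∩ ρ.symm ⁻¹' V) :=
  ρ.symm.isOpen_inter_preimage hV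

/-- The Hessian of an extension is diagonal in the frame. -/
lemma IsExtensionOn.isDiagonalAt {V : Set (Fin n → ℝ)} {η : (Fin n → ℝ) → ℝ}
    (hη : IsExtensionOn R V η) (hw : ρ.symm w ∈ V) :
    IsDiagonalAt R ρ (fderiv ℝ (fderiv ℝ η)) w (lengths R ρ η w) := by
  intro j k
  split_ifs with h
  · subst h; rfl
  · exact hη.2 _ hw j k h

lemma IsExtensionOn.contDiffOn_hessian {V : Set (Fin n → ℝ)} (hV : IsOpen V)
    {η : (Fin n → ℝ) → ℝ} (hη : IsExtensionOn R V η) :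
    ContDiffOn ℝ 1 (fderiv ℝ (fderiv ℝ η)) V :=
  (hη.1.fderiv_of_isOpen hV (m := 2) (by norm_num)).fderiv_of_isOpen hV (by norm_num)

/-- The lengths of an extension solve the `β`-system. -/
lemma IsExtensionOn.isBetaSolutionOn (hframe : IsFrameOn R ρ.source)
    (hρ : IsRiemannCoordinates R ρ)
    (hZ : ∀ i j k : Fin n, i ≠ j → j ≠ k → i ≠ k →
      ∀ w ∈ ρ.target, riemannChristoffel R ρ i j k w = 0)
    {V : Set (Fin n → ℝ)} (hV : IsOpen V) {η : (Fin n → ℝ) → ℝ} (hη : IsExtensionOn R V η) :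
    IsBetaSolutionOn R ρ (ρ.target ∩ ρ.symm ⁻¹' V) (lengths R ρ η) := by
  have hW : IsOpen (ρ.target ∩ ρ.symm ⁻¹' V) := isOpen_target_inter_preimage hV
  have hC : ContDiffOn ℝ 1 (lengths R ρ η) (ρ.target ∩ ρ.symm ⁻¹' V) := by
    refine contDiffOn_pi.2 fun i => ?_
    have hX : ContDiffOn ℝ 1 (coordField R ρ i) (ρ.target ∩ ρ.symm ⁻¹' V) :=
      ((contDiffOn_coordField hframe hρ i).of_le (by norm_num)).mono inter_subset_left
    have hH : ContDiffOn ℝ 1 (fun w => fderiv ℝ (fderiv ℝ η) (ρ.symm w))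
        (ρ.target ∩ ρ.symm ⁻¹' V) :=
      (hη.contDiffOn_hessian hV).comp
        (((hρ.contDiffOn_symm hframe).of_le (by norm_num)).mono inter_subset_left)
        fun _ hw => hw.2
    exact (hH.clm_apply hX).clm_apply hX
  refine ⟨hC, fun w hw i j hij => ?_⟩
  have hH : DifferentiableAt ℝ (fderiv ℝ (fderiv ℝ η)) (ρ.symm w) :=
    ((hη.contDiffOn_hessian hV).differentiableOn one_ne_zero).differentiableAt
      (hV.mem_nhds hw.2)
  have hdiag : ∀ᶠ x in 𝓝 w, IsDiagonalAt R ρ (fderiv ℝ (fderiv ℝ η)) x (lengths R ρ η x) := by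
    filter_upwards [hW.mem_nhds hw] with x hx using hη.isDiagonalAt hx.2
  have hg : ContDiffAt ℝ 2 (fderiv ℝ η) (ρ.symm w) :=
    (hη.1.fderiv_of_isOpen hV (m := 2) (by norm_num)).contDiffAt (hV.mem_nhds hw.2)
  rw [← DarbouxSystem.fderiv_comp_apply ((hC.differentiableOn one_ne_zero).differentiableAt
    (hW.mem_nhds hw))]
  exact (fderiv_diagonal_symm_iff hframe hρ hZ hw.1 hH hdiag).1
    (fun x y => (hg.isSymmSndFDerivAt (by simp)).eq x y) i j hij

/-- The field of bilinear forms `Σ_i γ^i dw^i ⊗ dw^i`. -/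
def diagonalForm (ρ : OpenPartialHomeomorph (Fin n → ℝ) (Fin n → ℝ))
    (γ : (Fin n → ℝ) → (Fin n → ℝ)) (u : Fin n → ℝ) : (Fin n → ℝ) →L[ℝ] (Fin n → ℝ) →L[ℝ] ℝ :=
  ∑ i, γ (ρ u) i • ((ContinuousLinearMap.proj (R := ℝ) (φ := fun _ : Fin n => ℝ) i).comp
    (fderiv ℝ ρ u)).smulRight
      ((ContinuousLinearMap.proj (R := ℝ) (φ := fun _ : Fin n => ℝ) i).comp (fderiv ℝ ρ u))

lemma diagonalForm_apply (u x y : Fin n → ℝ) :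
    diagonalForm ρ γ u x y = ∑ i, γ (ρ u) i * (fderiv ℝ ρ u x i * fderiv ℝ ρ u y i) := by
  simp [diagonalForm, sum_apply]

lemma isDiagonalAt_diagonalForm (hρ : IsRiemannCoordinates R ρ) (hw : w ∈ ρ.target) :
    IsDiagonalAt R ρ (diagonalForm ρ γ) w (γ w) := by
  intro j k
  rw [diagonalForm_apply, ρ.right_inv hw, coordField, coordField,
    hρ.fderiv_frame (ρ.map_target hw), hρ.fderiv_frame (ρ.map_target hw), Finset.sum_eq_single j]
  · simp [Pi.single_apply]
  · intro i _ hij; simp [hij]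
  · simp

lemma contDiffOn_diagonalForm (hframe : IsFrameOn R ρ.source) (hρ : IsRiemannCoordinates R ρ)
    {U : Set (Fin n → ℝ)} (hγ : ContDiffOn ℝ 1 γ U) :
    ContDiffOn ℝ 1 (diagonalForm ρ γ) (ρ.source ∩ ρ ⁻¹' U) := by
  have hρC := hρ.contDiffOn hframe
  have h1 : ContDiffOn ℝ 1 (fun u => γ (ρ u)) (ρ.source ∩ ρ ⁻¹' U) :=
    hγ.comp ((hρC.of_le (by norm_num)).mono inter_subset_left) fun _ hu => hu.2
  have h2 : ContDiffOn ℝ 1 (fderiv ℝ ρ) (ρ.source ∩ ρ ⁻¹' U) :=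
    (hρC.fderiv_of_isOpen ρ.open_source (m := 1) (by norm_num)).mono inter_subset_left
  unfold diagonalForm
  refine ContDiffOn.sum fun i _ => ?_
  have h3 : ContDiffOn ℝ 1 (fun u => (ContinuousLinearMap.proj (R := ℝ)
      (φ := fun _ : Fin n => ℝ) i).comp (fderiv ℝ ρ u)) (ρ.source ∩ ρ ⁻¹' U) :=
    contDiffOn_const.clm_comp h2
  exact (contDiffOn_pi.1 h1 i).smul (h3.smulRight h3)

/-- A `C¹` field of symmetric bilinear forms with symmetric derivative on an open convex set is a
Hessian. -/
lemma exists_hessian_eq {V : Set (Fin n → ℝ)} (hVo : IsOpen V) (hVc : Convex ℝ V)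
    (hH : ContDiffOn ℝ 1 H V) (hsymm : ∀ u ∈ V, ∀ x y, H u x y = H u y x)
    (hclosed : ∀ u ∈ V, ∀ x y, fderiv ℝ H u x y = fderiv ℝ H u y x) :
    ∃ η : (Fin n → ℝ) → ℝ, ContDiffOn ℝ 3 η V ∧
      ∀ u ∈ V, fderiv ℝ (fderiv ℝ η) u = H u := by
  obtain ⟨p, hp⟩ := hVc.exists_forall_hasFDerivAt_of_fderiv_symmetric hVo
    (hH.differentiableOn one_ne_zero) hclosed
  obtain ⟨η, hη⟩ := hVc.exists_forall_hasFDerivAt_of_fderiv_symmetric hVo (ω := p)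
    (fun u hu => (hp u hu).differentiableAt.differentiableWithinAt)
    (fun u hu x y => by rw [(hp u hu).fderiv, hsymm u hu])
  have hp2 : ContDiffOn ℝ (1 + 1) p V := by
    rw [contDiffOn_succ_iff_fderiv_of_isOpen hVo]
    exact ⟨fun u hu => (hp u hu).differentiableAt.differentiableWithinAt, by simp,
      hH.congr fun u hu => (hp u hu).fderiv⟩
  have hη3 : ContDiffOn ℝ (1 + 1 + 1) η V := by
    rw [contDiffOn_succ_iff_fderiv_of_isOpen hVo]
    exact ⟨fun u hu => (hη u hu).differentiableAt.differentiableWithinAt, by simp,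
      hp2.congr fun u hu => (hη u hu).fderiv⟩
  refine ⟨η, hη3.of_le (by norm_num), fun u hu => ?_⟩
  have he : fderiv ℝ η =ᶠ[𝓝 u] p := by
    filter_upwards [hVo.mem_nhds hu] with x hx using (hη x hx).fderiv
  rw [he.fderiv_eq, (hp u hu).fderiv]

/-- A solution of the `β`-system on `U` gives the lengths of an extension on convex sets. -/
lemma IsBetaSolutionOn.exists_extension (hframe : IsFrameOn R ρ.source)
    (hρ : IsRiemannCoordinates R ρ)
    (hZ : ∀ i j k : Fin n, i ≠ j → j ≠ k → i ≠ k →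
      ∀ w ∈ ρ.target, riemannChristoffel R ρ i j k w = 0)
    {U V : Set (Fin n → ℝ)} (hU : IsOpen U) (hγ : IsBetaSolutionOn R ρ U γ) (hVo : IsOpen V)
    (hVc : Convex ℝ V) (hV : V ⊆ ρ.source ∩ ρ ⁻¹' U) :
    ∃ η, IsExtensionOn R V η ∧ ∀ w ∈ ρ.target ∩ ρ.symm ⁻¹' V, lengths R ρ η w = γ w := by
  have hC := (contDiffOn_diagonalForm hframe hρ hγ.1).mono hV
  obtain ⟨η, hη, hηH⟩ := exists_hessian_eq hVo hVc hC
    (fun u _ x y => by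
      simp only [diagonalForm_apply]
      exact Finset.sum_congr rfl fun i _ => by ring)
    (fun u hu => by
      have hw : ρ u ∈ ρ.target := ρ.map_source (hV hu).1
      have hd := (hC.differentiableOn one_ne_zero).differentiableAt (hVo.mem_nhds hu)
      have hdiag : ∀ᶠ x in 𝓝 (ρ u), IsDiagonalAt R ρ (diagonalForm ρ γ) x (γ x) := by
        filter_upwards [ρ.open_target.mem_nhds hw] with x hx
          using isDiagonalAt_diagonalForm hρ hx
      rw [← ρ.left_inv (hV hu).1] at hd ⊢
      refine (fderiv_diagonal_symm_iff hframe hρ hZ hw hd hdiag).2 fun i j hij => ?_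
      rw [DarbouxSystem.fderiv_comp_apply ((hγ.1.differentiableOn one_ne_zero).differentiableAt
        (hU.mem_nhds (hV hu).2))]
      exact hγ.2 _ (hV hu).2 i j hij)
  refine ⟨η, ⟨hη, fun u hu i j hij => ?_⟩, fun w hw => ?_⟩
  · have := isDiagonalAt_diagonalForm (γ := γ) hρ (ρ.map_source (hV hu).1) i j
    rw [if_neg hij, coordField, coordField, ρ.left_inv (hV hu).1] at this
    rw [hessian, hηH u hu, this]
  · ext i
    have := isDiagonalAt_diagonalForm (γ := γ) hρ hw.1 i i
    rw [if_pos rfl] at this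
    rw [lengths, hessian, hηH _ hw.2]
    exact this

/-- Bilinear forms with the same diagonal entries in the frame are equal. -/
lemma IsDiagonalAt.eq (hρ : IsRiemannCoordinates R ρ) (hw : w ∈ ρ.target)
    {H' : (Fin n → ℝ) → (Fin n → ℝ) →L[ℝ] (Fin n → ℝ) →L[ℝ] ℝ} {g : Fin n → ℝ}
    (h : IsDiagonalAt R ρ H w g) (h' : IsDiagonalAt R ρ H' w g) :
    H (ρ.symm w) = H' (ρ.symm w) :=
  hρ.clm_ext hw fun i => hρ.clm_ext hw fun j => (h i j).trans (h' i j).symm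

/-- `C²` functions with the same Hessian near a point differ by an affine function there. -/
lemma exists_affine_of_hessian_eq {η η' : (Fin n → ℝ) → ℝ} {u : Fin n → ℝ}
    (hη : ContDiffAt ℝ 2 η u) (hη' : ContDiffAt ℝ 2 η' u)
    (h : ∀ᶠ x in 𝓝 u, fderiv ℝ (fderiv ℝ η') x = fderiv ℝ (fderiv ℝ η) x) :
    ∃ (a : Fin n → ℝ) (b : ℝ), η' =ᶠ[𝓝 u] fun x => η x + (∑ i, a i * x i) + b := by
  obtain ⟨ε, hε, hb⟩ := Metric.eventually_nhds_iff_ball.1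
    (h.and ((hη.eventually (by simp)).and (hη'.eventually (by simp))))
  have hpre := (convex_ball u ε).isPreconnected
  have hdd : ∀ {f : (Fin n → ℝ) → ℝ} {x}, ContDiffAt ℝ 2 f x → DifferentiableAt ℝ (fderiv ℝ f) x :=
    fun hf => (hf.fderiv_right (m := 1) (by norm_num)).differentiableAt one_ne_zero
  obtain ⟨A, hA⟩ := Metric.isOpen_ball.exists_eq_add_of_fderiv_eq hpre
    (fun x hx => (hdd (hb x hx).2.2).differentiableWithinAt)
    (fun x hx => (hdd (hb x hx).2.1).differentiableWithinAt) (fun x hx => (hb x hx).1)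
  obtain ⟨b, hb'⟩ := Metric.isOpen_ball.exists_eq_add_of_fderiv_eq hpre
    (g := fun x => η x + A x)
    (fun x hx => ((hb x hx).2.2.differentiableAt two_ne_zero).differentiableWithinAt)
    (fun x hx => (((hb x hx).2.1.differentiableAt two_ne_zero).add
      A.differentiableAt).differentiableWithinAt)
    (fun x hx => by
      rw [fderiv_fun_add ((hb x hx).2.1.differentiableAt two_ne_zero) A.differentiableAt,
        ContinuousLinearMap.fderiv]
      exact hA hx)
  refine ⟨fun i => A (Pi.single i 1), b, ?_⟩
  filter_upwards [Metric.ball_mem_nhds u hε] with x hx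
  have hx' : A x = ∑ i, A (Pi.single i 1) * x i := by
    conv_lhs => rw [show x = ∑ i, x i • (Pi.single i 1 : Fin n → ℝ) by
      ext j; simp [Pi.single_apply]]
    simp only [map_sum, map_smul, smul_eq_mul]
    exact Finset.sum_congr rfl fun i _ => mul_comm _ _
  rw [← hx']
  exact hb' hx

end

end BetaSystem

theorem theorem3p1 {n : ℕ}
    (R : Fin n → (Fin n → ℝ) → (Fin n → ℝ))
    (ρ : OpenPartialHomeomorph (Fin n → ℝ) (Fin n → ℝ))
    (hframe : BetaSystem.IsFrameOn R ρ.source)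
    (hrich : BetaSystem.IsRichOn R ρ.source)
    (hρ : BetaSystem.IsRiemannCoordinates R ρ)
    (hZ : ∀ i j k : Fin n, i ≠ j → j ≠ k → i ≠ k →
      ∀ w ∈ ρ.target, BetaSystem.riemannChristoffel R ρ i j k w = 0)
    (wbar : Fin n → ℝ) (hwbar : wbar ∈ ρ.target) :
    -- the algebraic part imposes no condition
    (∀ w ∈ ρ.target, ∀ g : Fin n → ℝ, BetaSystem.BetaAlgebraicAt R ρ w g) ∧
    ∀ φ : Fin n → ℝ → ℝ, (∀ i, ContDiffAt ℝ 1 (φ i) (wbar i)) →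
      -- existence and uniqueness of the local solution of the differential part
      (∃ U : Set (Fin n → ℝ), IsOpen U ∧ wbar ∈ U ∧ U ⊆ ρ.target ∧
        ∃ γ : (Fin n → ℝ) → (Fin n → ℝ),
          BetaSystem.IsBetaSolutionOn R ρ U γ ∧ BetaSystem.HasDataOn wbar φ U γ ∧
          (∀ δ : (Fin n → ℝ) → (Fin n → ℝ),
            BetaSystem.IsBetaSolutionOn R ρ U δ → BetaSystem.HasDataOn wbar φ U δ →
              EqOn δ γ U) ∧
          (∀ (V : Set (Fin n → ℝ)) (δ : (Fin n → ℝ) → (Fin n → ℝ)),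
            IsOpen V → wbar ∈ V → V ⊆ ρ.target →
            BetaSystem.IsBetaSolutionOn R ρ V δ → BetaSystem.HasDataOn wbar φ V δ →
              δ =ᶠ[𝓝 wbar] γ)) ∧
      -- existence, and uniqueness up to affine functions, of the corresponding extension
      (∃ V : Set (Fin n → ℝ), IsOpen V ∧ ρ.symm wbar ∈ V ∧ V ⊆ ρ.source ∧
        ∃ η : (Fin n → ℝ) → ℝ,
          BetaSystem.IsExtensionOn R V η ∧
          BetaSystem.HasDataOn wbar φ (ρ.target ∩ ρ.symm ⁻¹' V) (BetaSystem.lengths R ρ η) ∧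
          ∀ (V' : Set (Fin n → ℝ)) (η' : (Fin n → ℝ) → ℝ),
            IsOpen V' → ρ.symm wbar ∈ V' → V' ⊆ ρ.source →
            BetaSystem.IsExtensionOn R V' η' →
            BetaSystem.HasDataOn wbar φ (ρ.target ∩ ρ.symm ⁻¹' V')
              (BetaSystem.lengths R ρ η') →
              ∃ (a : Fin n → ℝ) (b : ℝ),
                η' =ᶠ[𝓝 (ρ.symm wbar)] fun u => η u + (∑ i, a i * u i) + b) := by
  refine ⟨fun w hw g i j k hij hki hkj => ?_, fun φ hφ => ?_⟩
  · rw [hZ i k j hki.symm hkj hij.ne w hw, hZ j k i hkj.symm hki hij.ne' w hw, zero_mul, zero_mul]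
  have htarget : ρ.target ∈ 𝓝 wbar := ρ.open_target.mem_nhds hwbar
  have hcd : ∀ i j k, ContDiffAt ℝ 1 (BetaSystem.riemannChristoffel R ρ i j k) wbar :=
    fun i j k => (BetaSystem.contDiffOn_riemannChristoffel hframe hρ i j k).contDiffAt htarget
  have hsolv := DarbouxSystem.eventually_exists_unique_solution
    (a := BetaSystem.betaLeft R ρ) (b := BetaSystem.betaRight R ρ)
    (fun i j _ => hcd j i j) (fun i j _ => (hcd j j i).neg)
    (by filter_upwards [htarget] with w hw using BetaSystem.compatibleAt_beta hframe hρ hZ hw) hφ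
  simp only [← BetaSystem.isBetaSolutionOn_iff] at hsolv
  -- Any two solutions with the data agree on a ball on which the Darboux system has one solution.
  have hlocal : ∀ {V V' : Set (Fin n → ℝ)} {γ δ : (Fin n → ℝ) → (Fin n → ℝ)},
      IsOpen V → wbar ∈ V → BetaSystem.IsBetaSolutionOn R ρ V γ →
      BetaSystem.HasDataOn wbar φ V γ → IsOpen V' → wbar ∈ V' →
      BetaSystem.IsBetaSolutionOn R ρ V' δ → BetaSystem.HasDataOn wbar φ V' δ →
      δ =ᶠ[𝓝 wbar] γ := by
    intro V V' γ δ hV hwV hγ hγ0 hV' hwV' hδ hδ0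
    obtain ⟨ε, hε, hεV⟩ := Metric.isOpen_iff.1 (hV.inter hV') wbar ⟨hwV, hwV'⟩
    obtain ⟨r, ⟨-, hr⟩, hr0, hrε⟩ := (hsolv.and (Ioo_mem_nhdsGT hε)).exists
    have hsub : Metric.ball wbar r ⊆ V ∩ V' := (Metric.ball_subset_ball hrε.le).trans hεV
    filter_upwards [Metric.ball_mem_nhds wbar hr0] with x hx
    exact hr δ γ
      ⟨hδ.1.mono fun y hy => (hsub hy).2, fun w hw => hδ.2 w (hsub hw).2⟩
      ⟨hγ.1.mono fun y hy => (hsub hy).1, fun w hw => hγ.2 w (hsub hw).1⟩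
      (fun i t ht => hδ0 i t (hsub ht).2) (fun i t ht => hγ0 i t (hsub ht).1) hx
  obtain ⟨ε, hε, hεt⟩ := Metric.isOpen_iff.1 ρ.open_target wbar hwbar
  obtain ⟨r, ⟨⟨γ, hγ, hγ0⟩, huniq⟩, hr0, hrε⟩ := (hsolv.and (Ioo_mem_nhdsGT hε)).exists
  have hUt : Metric.ball wbar r ⊆ ρ.target := (Metric.ball_subset_ball hrε.le).trans hεt
  have hwU : wbar ∈ Metric.ball wbar r := Metric.mem_ball_self hr0
  refine ⟨⟨Metric.ball wbar r, Metric.isOpen_ball, hwU, hUt, γ, hγ, hγ0,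
    fun δ hδ hδ0 => huniq δ γ hδ hγ hδ0 hγ0,
    fun V δ hV hwV _ hδ hδ0 => hlocal Metric.isOpen_ball hwU hγ hγ0 hV hwV hδ hδ0⟩, ?_⟩
  have hopen : IsOpen (ρ.source ∩ ρ ⁻¹' Metric.ball wbar r) :=
    ρ.isOpen_inter_preimage Metric.isOpen_ball
  -- The Poincaré lemma needs a convex domain in the coordinates `u`, so take a ball inside `ρ⁻¹(U)`.
  obtain ⟨s, hs0, hs⟩ := Metric.isOpen_iff.1 hopen (ρ.symm wbar)
    ⟨ρ.map_target hwbar, by rw [mem_preimage, ρ.right_inv hwbar]; exact hwU⟩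
  have huV : ρ.symm wbar ∈ Metric.ball (ρ.symm wbar) s := Metric.mem_ball_self hs0
  obtain ⟨η, hη, hηγ⟩ := hγ.exists_extension hframe hρ hZ Metric.isOpen_ball Metric.isOpen_ball
    (convex_ball _ _) hs
  have hdata : BetaSystem.HasDataOn wbar φ
      (ρ.target ∩ ρ.symm ⁻¹' Metric.ball (ρ.symm wbar) s) (BetaSystem.lengths R ρ η) := by
    intro i t ht
    rw [hηγ _ ht]
    refine hγ0 i t ?_
    have := (hs ht.2).2
    rwa [mem_preimage, ρ.right_inv ht.1] at this
  refine ⟨Metric.ball (ρ.symm wbar) s, Metric.isOpen_ball, huV, fun u hu => (hs hu).1, η, hη,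
    hdata, fun V' η' hV' huV' _ hη' hη'0 => ?_⟩
  have hlen : BetaSystem.lengths R ρ η' =ᶠ[𝓝 wbar] BetaSystem.lengths R ρ η :=
    hlocal (BetaSystem.isOpen_target_inter_preimage Metric.isOpen_ball) ⟨hwbar, huV⟩
      (hη.isBetaSolutionOn hframe hρ hZ Metric.isOpen_ball) hdata
      (BetaSystem.isOpen_target_inter_preimage hV') ⟨hwbar, huV'⟩
      (hη'.isBetaSolutionOn hframe hρ hZ hV') hη'0
  refine BetaSystem.exists_affine_of_hessian_eq
    ((hη.1.contDiffAt (Metric.isOpen_ball.mem_nhds huV)).of_le (by norm_num))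
    ((hη'.1.contDiffAt (hV'.mem_nhds huV')).of_le (by norm_num)) ?_
  have hu : ρ.symm wbar ∈ ρ.source := ρ.map_target hwbar
  have hlen' : ∀ᶠ u in 𝓝 (ρ.symm wbar),
      BetaSystem.lengths R ρ η' (ρ u) = BetaSystem.lengths R ρ η (ρ u) := by
    have hcont := ρ.continuousAt hu
    rw [ContinuousAt, ρ.right_inv hwbar] at hcont
    exact hcont.eventually hlen
  filter_upwards [hlen', ρ.open_source.mem_nhds hu, hV'.mem_nhds huV',
    Metric.isOpen_ball.mem_nhds huV] with u h1 h2 h3 h4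
  have hd' := hη'.isDiagonalAt (ρ := ρ) (w := ρ u) (by rwa [ρ.left_inv h2])
  have hd := hη.isDiagonalAt (ρ := ρ) (w := ρ u) (by rwa [ρ.left_inv h2])
  rw [h1] at hd'
  have := hd'.eq hρ (ρ.map_source h2) hd
  rwa [ρ.left_inv h2] at this
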